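/- Let $n\ge k\ge 1$ be integers. A set partition of $[n]=\{1,\dots,n\}$ is noncrossing if, whenever $1\le a<b<c<d\le n$ with $a,c$ in a common block and $b,d$ in a common block, all of $a,b,c,d$ lie in the same block. Let $X$ be the (finite) set of noncrossing partitions of $[n]$ with exactly $k$ blocks, and let $C=\mathbb Z/n\mathbb Z$ act on $X$ by rotation: the generator $c=1$ sends a partition $\pi$ to the partition obtained by replacing each element $i$ of each block by $i+1$, taken modulo $n$. Write $[r]_q=1+q+\dots+q^{r-1}$, $[m]!_q=[m]_q[m-1]_q\cdots[1]_q$ and ${n \brack j}_q=\frac{[n]!_q}{[j]!_q\,[n-j]!_q}$ for $0\le j\le n$. Then the $q$-Narayana number $$\mathrm{Nar}_q(n,k)=\frac{1}{[n]_q}{n \brack k}_q{n \brack k-1}_q$$ is a polynomial $X(q)$ in $q$ with nonnegative integer coefficients, and the triple $(X,C,X(q))$ exhibits the cyclic sieving phenomenon: for every $\zeta\in\mathbb C$ of multiplicative order $n$ and every integer $d\ge 0$, $$\#\{\pi\in X : c^d\cdot\pi=\pi\}=X(\zeta^d).$$ -/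

import Mathlib

open Polynomial

/-! ### Set partitions, noncrossing partitions and rotation -/

/-- The set partition `σ(π)`, obtained from the set partition `π` of `Fin n` by replacing every
element `i` of every block by `σ i`. -/
def permutePartition {n : ℕ} (σ : Equiv.Perm (Fin n))
    (π : Finpartition (Finset.univ : Finset (Fin n))) :
    Finpartition (Finset.univ : Finset (Fin n)) :=
  Finpartition.ofExistsUnique (π.parts.image fun B => B.image σ)
    (fun _ _ => Finset.subset_univ _)
    (by
      intro a _
      obtain ⟨B, ⟨hB, haB⟩, huniq⟩ := π.existsUnique_mem (Finset.mem_univ (σ⁻¹ a))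
      refine ⟨B.image σ, ⟨Finset.mem_image_of_mem _ hB, ?_⟩, ?_⟩
      · exact Finset.mem_image.2 ⟨σ⁻¹ a, haB, by simp⟩
      · rintro t ⟨ht, hat⟩
        obtain ⟨B', hB', rfl⟩ := Finset.mem_image.1 ht
        obtain ⟨x, hx, rfl⟩ := Finset.mem_image.1 hat
        rw [huniq B' ⟨hB', by simpa using hx⟩])
    (by
      intro h
      obtain ⟨B, hB, hB0⟩ := Finset.mem_image.1 h
      rw [Finset.image_eq_empty] at hB0
      exact π.ne_empty hB hB0)

theorem permutePartition_parts {n : ℕ} (σ : Equiv.Perm (Fin n))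
    (π : Finpartition (Finset.univ : Finset (Fin n))) :
    (permutePartition σ π).parts = π.parts.image fun B => B.image σ := rfl

theorem permutePartition_one {n : ℕ} (π : Finpartition (Finset.univ : Finset (Fin n))) :
    permutePartition 1 π = π := by
  apply Finpartition.ext
  simp [permutePartition_parts]

theorem permutePartition_mul {n : ℕ} (σ τ : Equiv.Perm (Fin n))
    (π : Finpartition (Finset.univ : Finset (Fin n))) :
    permutePartition (σ * τ) π = permutePartition σ (permutePartition τ π) := by
  apply Finpartition.ext
  simp [permutePartition_parts, Finset.image_image, Function.comp_def]

theorem card_permutePartition_parts {n : ℕ} (σ : Equiv.Perm (Fin n))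
    (π : Finpartition (Finset.univ : Finset (Fin n))) :
    (permutePartition σ π).parts.card = π.parts.card := by
  rw [permutePartition_parts]
  exact Finset.card_image_of_injective _ (Finset.image_injective σ.injective)

/-- A set partition is noncrossing if whenever `a < b < c < d` with `a, c` in a common block and
`b, d` in a common block, all four are in the same block. -/
def IsNoncrossing {n : ℕ} (π : Finpartition (Finset.univ : Finset (Fin n))) : Prop :=
  ∀ a b c d : Fin n, a < b → b < c → c < d →
    ∀ B ∈ π.parts, ∀ B' ∈ π.parts, a ∈ B → c ∈ B → b ∈ B' → d ∈ B' → B = B'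

/-- The noncrossing partitions of an `n`-element set with exactly `k` blocks. -/
abbrev NoncrossingPartition (n k : ℕ) : Type :=
  {π : Finpartition (Finset.univ : Finset (Fin n)) // IsNoncrossing π ∧ π.parts.card = k}

/-- The element `g` of `ℤ/nℤ` rotates the points `0, 1, …, n - 1` by `i ↦ i + g` modulo `n`;
in particular the generator `1` acts as the long cycle. -/
def cyclicRotation (n : ℕ) [NeZero n] : Multiplicative (ZMod n) →* Equiv.Perm (Fin n) :=
  MonoidHom.toHomPerm
    { toFun := fun g i => ⟨(i.val + g.toAdd.val) % n, Nat.mod_lt _ (NeZero.pos n)⟩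
      map_one' := by
        funext i
        apply Fin.ext
        change (i.val + (0 : ZMod n).val) % n = i.val
        simp [Nat.mod_eq_of_lt i.isLt]
      map_mul' := by
        intro g h
        funext i
        apply Fin.ext
        change (i.val + (g.toAdd + h.toAdd).val) % n =
          ((i.val + h.toAdd.val) % n + g.toAdd.val) % n
        rw [ZMod.val_add, Nat.add_mod_mod, Nat.mod_add_mod]
        congr 1
        omega }

theorem cyclicRotation_val {n : ℕ} [NeZero n] (g : Multiplicative (ZMod n)) (i : Fin n) :
    (cyclicRotation n g i).val = (i.val + g.toAdd.val) % n := rfl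

theorem IsNoncrossing.rotate {n : ℕ} [NeZero n] (g : Multiplicative (ZMod n))
    {π : Finpartition (Finset.univ : Finset (Fin n))} (hπ : IsNoncrossing π) :
    IsNoncrossing (permutePartition (cyclicRotation n g) π) := by
  intro a b c d hab hbc hcd B hB B' hB' haB hcB hbB' hdB'
  rw [permutePartition_parts] at hB hB'
  obtain ⟨B, hB₀, rfl⟩ := Finset.mem_image.1 hB
  obtain ⟨B', hB₁, rfl⟩ := Finset.mem_image.1 hB'
  obtain ⟨a, ha, rfl⟩ := Finset.mem_image.1 haB
  obtain ⟨b, hb, rfl⟩ := Finset.mem_image.1 hbB'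
  obtain ⟨c, hc, rfl⟩ := Finset.mem_image.1 hcB
  obtain ⟨d, hd, rfl⟩ := Finset.mem_image.1 hdB'
  have key : ∀ i : Fin n, (cyclicRotation n g i).val =
      if i.val + g.toAdd.val < n then i.val + g.toAdd.val else i.val + g.toAdd.val - n := by
    intro i
    have h1 := i.isLt
    have h2 := ZMod.val_lt g.toAdd
    rw [cyclicRotation_val]
    split_ifs with h
    · exact Nat.mod_eq_of_lt h
    · rw [Nat.mod_eq_sub_mod (by omega), Nat.mod_eq_of_lt (by omega)]
  rw [Fin.lt_def, key, key] at hab hbc hcd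
  have h1 := a.isLt
  have h2 := b.isLt
  have h3 := c.isLt
  have h4 := d.isLt
  have cases4 : (a < b ∧ b < c ∧ c < d) ∨ (b < c ∧ c < d ∧ d < a) ∨
      (c < d ∧ d < a ∧ a < b) ∨ (d < a ∧ a < b ∧ b < c) := by
    simp only [Fin.lt_def]
    split_ifs at hab hbc hcd <;> omega
  rcases cases4 with ⟨p, q, r⟩ | ⟨p, q, r⟩ | ⟨p, q, r⟩ | ⟨p, q, r⟩
  · rw [hπ a b c d p q r B hB₀ B' hB₁ ha hc hb hd]
  · rw [hπ b c d a p q r B' hB₁ B hB₀ hb hd hc ha]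
  · rw [hπ c d a b p q r B hB₀ B' hB₁ hc ha hd hb]
  · rw [hπ d a b c p q r B' hB₁ B hB₀ hd hb ha hc]

/-- The action of `ℤ/nℤ` by rotation on noncrossing partitions with `k` blocks. -/
instance cyclicRotationAction (n k : ℕ) [NeZero n] :
    MulAction (Multiplicative (ZMod n)) (NoncrossingPartition n k) where
  smul g π := ⟨permutePartition (cyclicRotation n g) π.1, π.2.1.rotate g, by
    rw [card_permutePartition_parts, π.2.2]⟩
  one_smul π := Subtype.ext (by
    change permutePartition (cyclicRotation n 1) π.1 = π.1
    rw [map_one, permutePartition_one])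
  mul_smul g h π := Subtype.ext (by
    change permutePartition (cyclicRotation n (g * h)) π.1 =
      permutePartition (cyclicRotation n g) (permutePartition (cyclicRotation n h) π.1)
    rw [map_mul, permutePartition_mul])

/-! ### The cyclic sieving phenomenon -/

/-- For a finite cyclic group `C = ⟨c⟩` acting on a finite set `X` and a polynomial `P` with
nonnegative integer coefficients, the triple `(X, C, P)` exhibits the cyclic sieving phenomenon:
for every complex `ζ` of multiplicative order `|C|` and every `d ≥ 0`, the number of `x ∈ X`
with `c ^ d • x = x` equals `P(ζ ^ d)`. -/
def ExhibitsCSP (X : Type*) {C : Type*} [Group C] [Finite C] [Finite X] [MulAction C X] (c : C)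
    (P : ℕ[X]) : Prop :=
  Subgroup.zpowers c = ⊤ ∧
    ∀ ζ : ℂ, orderOf ζ = Nat.card C → ∀ d : ℕ,
      (Nat.card (MulAction.fixedBy X (c ^ d)) : ℂ) = aeval (ζ ^ d) P

/-! ### `q`-analogues, as elements of the field `ℚ(q)` -/

/-- `[r]_q = 1 + q + ⋯ + q ^ (r - 1)`. -/
noncomputable def qInt (r : ℕ) : RatFunc ℚ := ∑ i ∈ Finset.range r, RatFunc.X ^ i

/-- `[m]!_q = [m]_q [m - 1]_q ⋯ [1]_q`. -/
noncomputable def qFactorial (m : ℕ) : RatFunc ℚ := ∏ i ∈ Finset.range m, qInt (i + 1)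

/-- The `q`-binomial coefficient `[n]!_q / ([k]!_q [n - k]!_q)`, for `k ≤ n`. -/
noncomputable def qBinomial (n k : ℕ) : RatFunc ℚ :=
  qFactorial n / (qFactorial k * qFactorial (n - k))

/-- The `q`-Narayana number, for `1 ≤ k ≤ n`. -/
noncomputable def qNarayana (n k : ℕ) : RatFunc ℚ :=
  1 / qInt n * qBinomial n k * qBinomial n (k - 1)

/-! ### Gaussian binomial polynomials -/

/-! Both sides are computed in closed form and compared. Put r = gcd(n, d) and m = n / r: then ω =
ζ^d has order m, and c^d fixes the same partitions as rotation by r.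

Polynomial side. For k ≥ 2 one has Nar_q(n,k) = [n-1, k-1]² - q [n-1, k-2] [n-1, k] (Gaussian
binomials), so nonnegativity is the q-log-concavity `exists_gauss_mul_gauss`. Moreover [k] Nar_q =
[n, k-1] [n-1, k-1] and [n-k+1] Nar_q = [n, k] [n-1, k-1]. For m ≥ 2 the q-Lucas theorem
`IsPrimitiveRoot.aeval_gauss` then gives the value at ω: C(r, j) C(r-1, j-1) if k = mj, C(r, j)
C(r-1, j) if k = mj + 1, and 0 otherwise.

Combinatorial side. Read ℤ as time, and let s ≥ 0 be a function on ℤ/rℤ with sum at most r. At time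
x push s(x) slots on a stack, then pop one if there is any. Times whose slots were pushed together
form a class, and the times that find nothing to pop (`IsRecordLow`) form one central class, which
exists exactly when the sum is less than r. The last-in-first-out rule makes the relation
noncrossing, and s(x) is the size of the class with least element x. This is the bijection
`periodicNoncrossingEquiv`. It is used twice.

For m ≥ 2, take a noncrossing partition fixed by rotation by r. A block that this rotation moves
must be short, as otherwise it crosses its own translate; hence the partition unrolls to an
r-periodic relation on ℤ. Each nonzero value of s yields m blocks and the central class yields one,
so k = m |supp s| + [sum s < r]. Counting such s (`card_sumSupport`, `sum_card_sumSupport`) gives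
the values above.

For m = 1 all partitions are counted. A partition of {1, …, n} is repeated with period n + 1, the
multiples of n + 1 being the central class; this corresponds to s on ℤ/(n+1)ℤ with sum n and a
record low at 0. By the cycle lemma `mul_card_isRecordLow_zero` these are a fraction 1/(n+1) of all
s with sum n, which yields the Narayana number P(1). -/

/-- The Gaussian binomial coefficient as a polynomial, defined by the `q`-Pascal rule. -/
noncomputable def gauss : ℕ → ℕ → ℕ[X]
  | _, 0 => 1
  | 0, _ + 1 => 0
  | n + 1, k + 1 => gauss n k + X ^ (k + 1) * gauss n (k + 1)

@[simp] theorem gauss_zero_right (n : ℕ) : gauss n 0 = 1 := by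
  cases n <;> rfl

@[simp] theorem gauss_zero_succ (k : ℕ) : gauss 0 (k + 1) = 0 := rfl

theorem gauss_succ_succ (n k : ℕ) :
    gauss (n + 1) (k + 1) = gauss n k + X ^ (k + 1) * gauss n (k + 1) := rfl

theorem gauss_eq_zero_of_lt : ∀ {n k : ℕ}, n < k → gauss n k = 0
  | 0, k + 1, _ => rfl
  | n + 1, k + 1, h => by
    rw [gauss_succ_succ, gauss_eq_zero_of_lt (by omega), gauss_eq_zero_of_lt (by omega)]
    simp

@[simp] theorem gauss_self (n : ℕ) : gauss n n = 1 := by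
  induction n with
  | zero => rfl
  | succ n ih => rw [gauss_succ_succ, ih, gauss_eq_zero_of_lt (Nat.lt_succ_self n)]; simp

theorem gauss_eval_one (n k : ℕ) : (gauss n k).eval 1 = n.choose k := by
  induction n generalizing k with
  | zero => cases k <;> simp
  | succ n ih => cases k with
    | zero => simp
    | succ k => rw [gauss_succ_succ]; simp [ih, Nat.choose_succ_succ]

/-! ### Coefficientwise log-concavity -/

/-- Log-concavity with respect to the coefficientwise order, for sequences whose index is shifted
by one (so that the entry at `0` plays the role of the entry at `-1`). -/
def StronglyLogConcave (u : ℕ → ℕ[X]) : Prop :=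
  ∀ a b : ℕ, a ≤ b → ∃ D : ℕ[X], u (a + 1) * u (b + 1) = u a * u (b + 2) + D

theorem StronglyLogConcave.twist {u : ℕ → ℕ[X]} (hu : StronglyLogConcave u) :
    StronglyLogConcave fun k => X ^ k * u k := by
  intro a b hab
  obtain ⟨D, hD⟩ := hu a b hab
  refine ⟨X ^ (a + b + 2) * D, ?_⟩
  calc X ^ (a + 1) * u (a + 1) * (X ^ (b + 1) * u (b + 1))
      = X ^ (a + b + 2) * (u (a + 1) * u (b + 1)) := by ring
    _ = _ := by rw [hD]; ring

/-- Expanding both products gives four terms each, and these compare in pairs by the hypothesis on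
`u`. This is why all a ≤ b are needed and not only a = b. -/
theorem StronglyLogConcave.add_shift {u v : ℕ → ℕ[X]} (hu : StronglyLogConcave u)
    (hv0 : v 0 = 0) (hv : ∀ k, v (k + 1) = u (k + 1) + u k) : StronglyLogConcave v := by
  intro a b hab
  obtain _ | a := a
  · exact ⟨v 1 * v (b + 1), by simp [hv0]⟩
  obtain _ | b := b
  · omega
  obtain ⟨D₁, h₁⟩ := hu (a + 1) (b + 1) hab
  obtain ⟨D₂, h₂⟩ := hu a b (by omega)
  obtain ⟨D₃, h₃⟩ := hu a (b + 1) (by omega)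
  have h₄ : ∃ D, u (a + 2) * u (b + 1) = u (a + 1) * u (b + 2) + D := by
    rcases (Nat.le_of_succ_le_succ hab).eq_or_lt with rfl | h
    · exact ⟨0, by ring⟩
    · exact hu (a + 1) b h
  obtain ⟨D₄, h₄⟩ := h₄
  refine ⟨D₁ + D₂ + D₃ + D₄, ?_⟩
  simp only [hv]
  calc (u (a + 1 + 1) + u (a + 1)) * (u (b + 1 + 1) + u (b + 1))
      = u (a + 1 + 1) * u (b + 1 + 1) + u (a + 1) * u (b + 1) + u (a + 2) * u (b + 1)
        + u (a + 1) * u (b + 1 + 1) := by ring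
    _ = _ := by rw [h₁, h₂, h₃, h₄]; ring

/-- The sequence of Gaussian binomials, weighted by powers of `q` and shifted by one. -/
noncomputable def weightedGauss (n : ℕ) : ℕ → ℕ[X]
  | 0 => 0
  | k + 1 => X ^ (k.choose 2 + n) * gauss n k

/-- The summand `n` in the exponent compensates the index shift: the q-Pascal rule becomes
multiplication by X to the index followed by adding neighbours, which is `twist` followed by
`add_shift`. -/
theorem weightedGauss_succ (n k : ℕ) : weightedGauss (n + 1) (k + 1) =
    X ^ (k + 1) * weightedGauss n (k + 1) + X ^ k * weightedGauss n k := by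
  cases k with
  | zero => simp [weightedGauss, pow_succ, mul_comm]
  | succ k =>
    have h : (k + 1).choose 2 = k + k.choose 2 := by
      rw [Nat.choose_succ_succ' k 1]; simp
    simp only [weightedGauss, gauss_succ_succ, h]
    ring

theorem stronglyLogConcave_weightedGauss (n : ℕ) : StronglyLogConcave (weightedGauss n) := by
  induction n with
  | zero =>
    intro a b _
    refine ⟨weightedGauss 0 (a + 1) * weightedGauss 0 (b + 1), ?_⟩
    simp [weightedGauss]
  | succ n ih => exact ih.twist.add_shift rfl (weightedGauss_succ n)

theorem exists_eq_add_of_coeff_le {A B : ℕ[X]} (h : ∀ i, B.coeff i ≤ A.coeff i) :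
    ∃ P, A = B + P := by
  refine ⟨∑ i ∈ Finset.range (A.natDegree + 1), monomial i (A.coeff i - B.coeff i), ?_⟩
  ext i
  simp only [coeff_add, finsetSum_coeff, coeff_monomial, Finset.sum_ite_eq', Finset.mem_range]
  have := h i
  split_ifs with hi
  · omega
  · have := coeff_eq_zero_of_natDegree_lt (p := A) (n := i) (by omega)
    omega

/-- `q`-log-concavity of the Gaussian binomials. -/
theorem exists_gauss_mul_gauss (n k : ℕ) : ∃ P : ℕ[X],
    gauss n (k + 1) * gauss n (k + 1) = X * (gauss n k * gauss n (k + 2)) + P := by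
  obtain ⟨D, hD⟩ := stronglyLogConcave_weightedGauss n (k + 1) (k + 1) le_rfl
  apply exists_eq_add_of_coeff_le
  have h1 : (k + 1).choose 2 = k + k.choose 2 := by
    rw [Nat.choose_succ_succ' k 1]; simp
  have h2 : (k + 2).choose 2 = k + 1 + (k + 1).choose 2 := by
    rw [Nat.choose_succ_succ' (k + 1) 1]; simp
  simp only [weightedGauss, h2, h1] at hD
  -- The outer product carries exactly one more power of X than the square of the middle term, since
  -- C(k,2) + C(k+2,2) = 2 C(k+1,2) + 1. The common power is then cancelled coefficientwise.
  have key : X ^ (2 * (k + k.choose 2 + n)) * (gauss n (k + 1) * gauss n (k + 1)) =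
      X ^ (2 * (k + k.choose 2 + n)) * (X * (gauss n k * gauss n (k + 2))) + D := by
    calc _ = _ := by ring
      _ = _ := hD
      _ = _ := by ring
  intro i
  have := congrArg (fun p => coeff p (i + 2 * (k + k.choose 2 + n))) key
  simp only [coeff_add, coeff_X_pow_mul] at this
  omega

/-! ### Comparison with the quotients of `q`-factorials -/

/-- The image of a polynomial with natural coefficients in `ℚ(q)`. -/
noncomputable def toRatFunc : ℕ[X] →+* RatFunc ℚ :=
  (algebraMap ℚ[X] (RatFunc ℚ)).comp (mapRingHom (Nat.castRingHom ℚ))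

theorem toRatFunc_injective : Function.Injective toRatFunc := by
  refine (RatFunc.algebraMap_injective ℚ).comp ?_
  exact map_injective _ Nat.cast_injective

@[simp] theorem toRatFunc_X : toRatFunc X = RatFunc.X := by
  simp [toRatFunc]

/-- The polynomial `1 + q + ⋯ + q ^ (r - 1)`. -/
noncomputable def qIntPoly (r : ℕ) : ℕ[X] := ∑ i ∈ Finset.range r, X ^ i

theorem toRatFunc_qIntPoly (r : ℕ) : toRatFunc (qIntPoly r) = qInt r := by
  simp [qIntPoly, qInt]

theorem qInt_ne_zero (r : ℕ) : qInt (r + 1) ≠ 0 := by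
  rw [← toRatFunc_qIntPoly, map_ne_zero_iff _ toRatFunc_injective]
  intro h
  have := congrArg (eval 1) h
  simp [qIntPoly, eval_finsetSum] at this

theorem qInt_add (a b : ℕ) : qInt (a + b) = qInt a + RatFunc.X ^ a * qInt b := by
  simp only [qInt, Finset.sum_range_add, Finset.mul_sum, pow_add]

theorem qInt_one : qInt 1 = 1 := by simp [qInt]

theorem qInt_one_add (a : ℕ) : qInt (a + 1) = 1 + RatFunc.X * qInt a := by
  rw [add_comm, qInt_add, qInt_one, pow_one]

theorem X_pow_eq_qInt (a : ℕ) :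
    (RatFunc.X ^ a : RatFunc ℚ) = 1 + (RatFunc.X - 1) * qInt a := by
  rw [qInt, mul_comm, geom_sum_mul]
  ring

theorem qFactorial_succ (m : ℕ) : qFactorial (m + 1) = qFactorial m * qInt (m + 1) := by
  simp [qFactorial, Finset.prod_range_succ]

theorem qFactorial_ne_zero (m : ℕ) : qFactorial m ≠ 0 :=
  Finset.prod_ne_zero_iff.2 fun i _ => qInt_ne_zero i

theorem toRatFunc_gauss_mul (a b : ℕ) :
    toRatFunc (gauss (a + b) a) * (qFactorial a * qFactorial b) = qFactorial (a + b) := by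
  induction h : a + b generalizing a b with
  | zero =>
    obtain ⟨rfl, rfl⟩ : a = 0 ∧ b = 0 := by omega
    simp [qFactorial]
  | succ n ih =>
    obtain _ | a := a
    · obtain rfl : b = n + 1 := by omega
      simp [qFactorial]
    obtain _ | b := b
    · obtain rfl : a = n := by omega
      simp [qFactorial]
    have h1 := ih a (b + 1) (by omega)
    have h2 := ih (a + 1) b (by omega)
    -- This splitting of [n+1] matches the two terms of the q-Pascal rule.
    have h3 : qInt (n + 1) = qInt (a + 1) + RatFunc.X ^ (a + 1) * qInt (b + 1) := by
      rw [← qInt_add, ← h]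
    rw [gauss_succ_succ, map_add, map_mul, map_pow, toRatFunc_X, qFactorial_succ n, h3]
    linear_combination (qInt (a + 1)) * h1 + RatFunc.X ^ (a + 1) * qInt (b + 1) * h2 +
      (toRatFunc (gauss n a) * qFactorial (b + 1)) * qFactorial_succ a +
      RatFunc.X ^ (a + 1) * toRatFunc (gauss n (a + 1)) * qFactorial (a + 1) * qFactorial_succ b

theorem toRatFunc_gauss (a b : ℕ) :
    toRatFunc (gauss (a + b) a) = qBinomial (a + b) a := by
  rw [qBinomial, Nat.add_sub_cancel_left, eq_div_iff, toRatFunc_gauss_mul]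
  exact mul_ne_zero (qFactorial_ne_zero a) (qFactorial_ne_zero b)

theorem qBinomial_absorb_right (a b : ℕ) :
    qInt (a + 1) * qBinomial (a + 1 + b) (a + 1) = qInt (a + 1 + b) * qBinomial (a + b) a := by
  have h := qFactorial_succ (a + b)
  rw [show a + b + 1 = a + 1 + b by omega] at h
  simp only [qBinomial, Nat.add_sub_cancel_left, h, qFactorial_succ a]
  have h1 := qFactorial_ne_zero a
  have h2 := qFactorial_ne_zero b
  have h3 := qInt_ne_zero a
  field_simp

theorem qBinomial_absorb_left (a b : ℕ) :
    qInt (b + 1) * qBinomial (a + b + 1) a = qInt (a + b + 1) * qBinomial (a + b) a := by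
  have h := qFactorial_succ (a + b)
  rw [qBinomial, qBinomial, show a + b + 1 - a = b + 1 by omega, Nat.add_sub_cancel_left,
    h, qFactorial_succ b]
  have h1 := qFactorial_ne_zero a
  have h2 := qFactorial_ne_zero b
  have h3 := qInt_ne_zero b
  field_simp

/-- With k = a + 1 and n - k = b, this and `qInt_mul_qNarayana_right` clear the denominator [n] at
the cost of [k] or [n-k+1]. At a root of unity of order m dividing n, the second factor is 1 if m ∣
k, the first is 1 if m ∣ k - 1, and otherwise the first is nonzero. -/
theorem qInt_mul_qNarayana_left (a b : ℕ) : qInt (a + 1) * qNarayana (a + 1 + b) (a + 1) =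
    toRatFunc (gauss (a + 1 + b) a) * toRatFunc (gauss (a + b) a) := by
  have h1 := qBinomial_absorb_right a b
  have h2 : qInt (a + 1 + b) ≠ 0 := by
    rw [show a + 1 + b = a + b + 1 by omega]; exact qInt_ne_zero _
  rw [toRatFunc_gauss, show gauss (a + 1 + b) a = gauss (a + (b + 1)) a by congr 1; omega,
    toRatFunc_gauss, qNarayana, Nat.add_sub_cancel,
    show a + (b + 1) = a + 1 + b by omega]
  field_simp
  linear_combination qBinomial (a + 1 + b) a * h1

theorem qInt_mul_qNarayana_right (a b : ℕ) : qInt (b + 1) * qNarayana (a + 1 + b) (a + 1) =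
    toRatFunc (gauss (a + 1 + b) (a + 1)) * toRatFunc (gauss (a + b) a) := by
  have h1 := qBinomial_absorb_left a b
  have h2 : qInt (a + 1 + b) ≠ 0 := by
    rw [show a + 1 + b = a + b + 1 by omega]; exact qInt_ne_zero _
  rw [toRatFunc_gauss, toRatFunc_gauss, qNarayana, Nat.add_sub_cancel]
  rw [show a + b + 1 = a + 1 + b by omega] at h1
  field_simp
  linear_combination qBinomial (a + 1 + b) (a + 1) * h1

theorem qInt_mul_toRatFunc_gauss (a b : ℕ) : qInt (a + 1) * toRatFunc (gauss (a + b) (a + 1)) =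
    qInt b * toRatFunc (gauss (a + b) a) := by
  obtain _ | b := b
  · rw [gauss_eq_zero_of_lt (by omega)]
    simp [qInt]
  rw [toRatFunc_gauss, show a + (b + 1) = a + 1 + b by omega, toRatFunc_gauss,
    qBinomial_absorb_right, ← show a + b + 1 = a + 1 + b by omega, qBinomial_absorb_left]

/-- The `q`-Narayana number is a polynomial with natural coefficients. -/
theorem exists_toRatFunc_eq_qNarayana (a b : ℕ) :
    ∃ P : ℕ[X], toRatFunc P = qNarayana (a + 1 + b) (a + 1) := by
  have hab : qInt (a + 1 + b) ≠ 0 := by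
    rw [show a + 1 + b = a + b + 1 by omega]; exact qInt_ne_zero _
  have hb := qInt_ne_zero b
  have h1 := qInt_mul_qNarayana_right a b
  rw [toRatFunc_gauss (a + 1) b] at h1
  have h2 := qBinomial_absorb_right a b
  rw [← toRatFunc_gauss a b] at h2
  obtain _ | a := a
  · refine ⟨1, ?_⟩
    rw [map_one]
    simp only [zero_add, gauss_zero_right, map_one, mul_one, qInt_one, one_mul] at h1 h2
    rw [h2, add_comm 1 b] at h1
    rw [zero_add, add_comm 1 b]
    exact (mul_left_cancel₀ hb (h1.trans (mul_one _).symm)).symm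
  -- The witness is the excess in q-log-concavity: with n - 1 = a + 1 + b it is x² - q z y in the
  -- notation below.
  · obtain ⟨P, hP⟩ := exists_gauss_mul_gauss (a + 1 + b) a
    refine ⟨P, ?_⟩
    replace hP := congrArg toRatFunc hP
    simp only [map_add, map_mul, toRatFunc_X] at hP
    have ha := qInt_ne_zero (a + 1)
    have h3 := qInt_mul_toRatFunc_gauss (a + 1) b
    have h4 := qInt_mul_toRatFunc_gauss a (b + 1)
    rw [show a + (b + 1) = a + 1 + b by omega] at h4
    have e1 : qInt (a + 1 + 1) = 1 + RatFunc.X * qInt (a + 1) := qInt_one_add _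
    have e2 : qInt (b + 1) = 1 + RatFunc.X * qInt b := qInt_one_add _
    have e3 : qInt (a + 1 + 1 + b) = 1 + RatFunc.X *
        (qInt (a + 1) + (1 + (RatFunc.X - 1) * qInt (a + 1)) * qInt b) := by
      rw [show a + 1 + 1 + b = a + 1 + b + 1 by omega, qInt_one_add, qInt_add (a + 1) b,
        X_pow_eq_qInt]
    have e4 : qInt (a + 1 + 1 + b) = qInt (a + 1 + 1) * qInt (b + 1) -
        RatFunc.X * qInt b * qInt (a + 1) := by
      rw [e1, e2, e3]; ring
    apply mul_left_cancel₀ (mul_ne_zero ha hb)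
    set x := toRatFunc (gauss (a + 1 + b) (a + 1))
    set y := toRatFunc (gauss (a + 1 + b) (a + 2))
    set z := toRatFunc (gauss (a + 1 + b) a)
    have h5 : qInt (a + 1 + 1) * qInt (b + 1) * qNarayana (a + 1 + 1 + b) (a + 1 + 1) =
        qInt (a + 1 + 1 + b) * x * x := by
      rw [← h2, mul_assoc, h1]; ring
    rw [h5, e4]
    linear_combination (-(qInt (a + 1 + 1) * qInt (b + 1))) * hP
      + RatFunc.X * (-(qInt (b + 1) * z)) * h3 + RatFunc.X * (qInt b * x) * h4

/-! ### Values at roots of unity -/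

theorem qIntPoly_mul_left {a b : ℕ} {P : ℕ[X]} (hP : toRatFunc P = qNarayana (a + 1 + b) (a + 1)) :
    qIntPoly (a + 1) * P = gauss (a + 1 + b) a * gauss (a + b) a := by
  apply toRatFunc_injective
  rw [map_mul, map_mul, hP, toRatFunc_qIntPoly, qInt_mul_qNarayana_left]

theorem qIntPoly_mul_right {a b : ℕ} {P : ℕ[X]} (hP : toRatFunc P = qNarayana (a + 1 + b) (a + 1)) :
    qIntPoly (b + 1) * P = gauss (a + 1 + b) (a + 1) * gauss (a + b) a := by
  apply toRatFunc_injective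
  rw [map_mul, map_mul, hP, toRatFunc_qIntPoly, qInt_mul_qNarayana_right]

theorem mul_eval_one_of_eq_qNarayana {a b : ℕ} {P : ℕ[X]}
    (hP : toRatFunc P = qNarayana (a + 1 + b) (a + 1)) :
    (a + 1) * P.eval 1 = (a + 1 + b).choose a * (a + b).choose a := by
  have h := congrArg (eval 1) (qIntPoly_mul_left hP)
  simpa [qIntPoly, eval_finsetSum, gauss_eval_one] using h

theorem qIntPoly_mul_gauss (a b : ℕ) :
    qIntPoly (a + 1) * gauss (a + 1 + b) (a + 1) = qIntPoly (a + 1 + b) * gauss (a + b) a := by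
  apply toRatFunc_injective
  rw [map_mul, map_mul, toRatFunc_qIntPoly, toRatFunc_qIntPoly, toRatFunc_gauss, toRatFunc_gauss,
    qBinomial_absorb_right]

section RootOfUnity

variable {ω : ℂ} {m : ℕ}

theorem aeval_qIntPoly_mul (k : ℕ) : aeval ω (qIntPoly k) * (ω - 1) = ω ^ k - 1 := by
  simp [qIntPoly, geom_sum_mul]

theorem IsPrimitiveRoot.aeval_qIntPoly_eq_zero (hω : IsPrimitiveRoot ω m) (hm : 1 < m) {k : ℕ}
    (hk : m ∣ k) : aeval ω (qIntPoly k) = 0 := by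
  have h := aeval_qIntPoly_mul (ω := ω) k
  rw [(hω.pow_eq_one_iff_dvd k).2 hk, sub_self] at h
  exact (mul_eq_zero.1 h).resolve_right (sub_ne_zero.2 (hω.ne_one hm))

theorem IsPrimitiveRoot.aeval_qIntPoly_ne_zero (hω : IsPrimitiveRoot ω m) {k : ℕ}
    (hk : ¬ m ∣ k) : aeval ω (qIntPoly k) ≠ 0 := by
  intro h0
  have h := aeval_qIntPoly_mul (ω := ω) k
  rw [h0, zero_mul, eq_comm, sub_eq_zero, hω.pow_eq_one_iff_dvd] at h
  exact hk h

theorem IsPrimitiveRoot.aeval_qIntPoly_succ (hω : IsPrimitiveRoot ω m) (hm : 1 < m) {k : ℕ}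
    (hk : m ∣ k) : aeval ω (qIntPoly (k + 1)) = 1 := by
  rw [qIntPoly, Finset.sum_range_succ, map_add, ← qIntPoly, hω.aeval_qIntPoly_eq_zero hm hk]
  simp [(hω.pow_eq_one_iff_dvd k).2 hk]

theorem IsPrimitiveRoot.aeval_gauss_eq_zero (hω : IsPrimitiveRoot ω m) (hm : 1 < m) {k : ℕ}
    (hk : 0 < k) (hkm : k < m) : aeval ω (gauss m k) = 0 := by
  obtain ⟨a, rfl⟩ : ∃ a, k = a + 1 := ⟨k - 1, by omega⟩
  obtain ⟨b, rfl⟩ : ∃ b, m = a + 1 + b := ⟨m - (a + 1), by omega⟩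
  have h := congrArg (aeval ω) (qIntPoly_mul_gauss a b)
  rw [map_mul, map_mul, hω.aeval_qIntPoly_eq_zero hm dvd_rfl, zero_mul] at h
  exact (mul_eq_zero.1 h).resolve_left
    (hω.aeval_qIntPoly_ne_zero (Nat.not_dvd_of_pos_of_lt hk hkm))

/-- For b = 0 the inner Gaussian binomials of row m vanish at ω. The q-Pascal rule propagates the
identity, because its factor ω^(k+1) does not change when k is shifted by m. -/
theorem IsPrimitiveRoot.aeval_gauss_add (hω : IsPrimitiveRoot ω m) (hm : 1 < m) (b k : ℕ) :
    aeval ω (gauss (m + b) k) =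
      aeval ω (gauss b k) + if m ≤ k then aeval ω (gauss b (k - m)) else 0 := by
  induction b generalizing k with
  | zero =>
    rcases Nat.eq_zero_or_pos k with rfl | hk
    · simp [show m ≠ 0 by omega]
    rw [add_zero, gauss_eq_zero_of_lt hk, map_zero, zero_add]
    rcases lt_trichotomy k m with h | rfl | h
    · rw [hω.aeval_gauss_eq_zero hm hk h, if_neg (by omega)]
    · simp
    · rw [gauss_eq_zero_of_lt h, if_pos h.le, gauss_eq_zero_of_lt (by omega)]
  | succ b ih =>
    obtain _ | k := k
    · simp [show m ≠ 0 by omega]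
    rw [← add_assoc, gauss_succ_succ, gauss_succ_succ, map_add, map_add, map_mul, map_mul, ih, ih]
    rcases lt_trichotomy m (k + 1) with h | rfl | h
    · obtain ⟨c, rfl⟩ : ∃ c, k = m + c := ⟨k - m, by omega⟩
      simp only [show m ≤ m + c by omega, show m ≤ m + c + 1 by omega, if_true,
        show m + c - m = c by omega, show m + c + 1 - m = c + 1 by omega, gauss_succ_succ,
        map_add, map_mul, map_pow, aeval_X]
      rw [show m + c + 1 = m + (c + 1) by omega, pow_add ω m, hω.pow_eq_one]
      ring
    · simp [hω.pow_eq_one, map_pow]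
      ring
    · simp [show ¬ m ≤ k by omega, show ¬ m ≤ k + 1 by omega]

/-- The `q`-Lucas theorem. -/
theorem IsPrimitiveRoot.aeval_gauss (hω : IsPrimitiveRoot ω m) (hm : 1 < m) (r j : ℕ) {b i : ℕ}
    (hb : b < m) (hi : i < m) :
    aeval ω (gauss (m * r + b) (m * j + i)) = r.choose j * aeval ω (gauss b i) := by
  induction r generalizing j with
  | zero =>
    obtain _ | j := j
    · simp
    · rw [gauss_eq_zero_of_lt (by rw [mul_add]; omega)]
      simp
  | succ r ih =>
    rw [show m * (r + 1) + b = m + (m * r + b) by ring, hω.aeval_gauss_add hm, ih]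
    obtain _ | j := j
    · simp [show ¬ m ≤ i by omega]
    · rw [show m * (j + 1) + i - m = m * j + i by rw [mul_add]; omega, ih,
        if_pos (by rw [mul_add]; omega), Nat.choose_succ_succ]
      push_cast
      ring

theorem IsPrimitiveRoot.aeval_gauss_mul (hω : IsPrimitiveRoot ω m) (hm : 1 < m) (r j : ℕ) :
    aeval ω (gauss (m * r) (m * j)) = r.choose j := by
  simpa using hω.aeval_gauss hm r j (b := 0) (i := 0) (by omega) (by omega)

theorem IsPrimitiveRoot.aeval_gauss_mul_of_not_dvd (hω : IsPrimitiveRoot ω m) (hm : 1 < m)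
    (r : ℕ) {k : ℕ} (hk : ¬ m ∣ k) : aeval ω (gauss (m * r) k) = 0 := by
  have h := hω.aeval_gauss hm r (k / m) (b := 0) (i := k % m) (by omega)
    (Nat.mod_lt _ (by omega))
  rw [Nat.div_add_mod, gauss_eq_zero_of_lt (n := 0)] at h
  · simpa using h
  · exact Nat.pos_of_ne_zero fun h0 => hk (Nat.dvd_of_mod_eq_zero h0)

/-- The value of the `q`-Narayana number at a root of unity of order `m`, when `m ∣ k`. -/
theorem IsPrimitiveRoot.aeval_qNarayana_of_dvd (hω : IsPrimitiveRoot ω m) (hm : 1 < m)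
    {r j : ℕ} (hjr : j + 1 ≤ r) {P : ℕ[X]} (hP : toRatFunc P = qNarayana (m * r) (m * (j + 1))) :
    aeval ω P = ((r.choose (j + 1) * (r - 1).choose j : ℕ) : ℂ) := by
  obtain ⟨c, rfl⟩ : ∃ c, r = j + 1 + c := ⟨r - (j + 1), by omega⟩
  obtain ⟨a, ha⟩ : ∃ a, m * (j + 1) = a + 1 :=
    ⟨m * (j + 1) - 1, by have : 0 < m * (j + 1) := by positivity
                         omega⟩
  have hn : m * (j + 1 + c) = a + 1 + m * c := by rw [← ha, mul_add]
  rw [ha, hn] at hP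
  have h := congrArg (aeval ω) (qIntPoly_mul_right hP)
  rw [map_mul, map_mul, hω.aeval_qIntPoly_succ hm (dvd_mul_right m c), one_mul] at h
  have h1 : aeval ω (gauss (a + 1 + m * c) (a + 1)) = (j + 1 + c).choose (j + 1) := by
    rw [← hn, ← ha, hω.aeval_gauss_mul hm]
  have h2 : aeval ω (gauss (a + m * c) a) = (j + c).choose j := by
    -- Base-m digits: n - 1 = m (j + c) + (m - 1) and k - 1 = m j + (m - 1), so the lower factor is
    -- 1.
    have := hω.aeval_gauss hm (j + c) j (b := m - 1) (i := m - 1) (by omega) (by omega)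
    rw [gauss_self, map_one, mul_one] at this
    rw [← this, mul_add]
    rw [mul_add] at ha
    congr 2 <;> omega
  rw [h, h1, h2, show j + 1 + c - 1 = j + c by omega]
  push_cast
  rfl

/-- The value of the `q`-Narayana number at a root of unity of order `m`, when `m ∣ k - 1`. -/
theorem IsPrimitiveRoot.aeval_qNarayana_of_dvd_pred (hω : IsPrimitiveRoot ω m) (hm : 1 < m)
    {r j : ℕ} (hjr : j < r) {P : ℕ[X]} (hP : toRatFunc P = qNarayana (m * r) (m * j + 1)) :
    aeval ω P = ((r.choose j * (r - 1).choose j : ℕ) : ℂ) := by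
  obtain ⟨c, rfl⟩ : ∃ c, r = j + 1 + c := ⟨r - (j + 1), by omega⟩
  obtain ⟨b, hb⟩ : ∃ b, m * (j + 1 + c) = m * j + 1 + b := by
    refine ⟨m * (j + 1 + c) - (m * j + 1), ?_⟩
    have : m * (j + 1 + c) = m * j + m * (1 + c) := by ring
    have : 1 < m * (1 + c) := by nlinarith
    omega
  rw [hb] at hP
  have h := congrArg (aeval ω) (qIntPoly_mul_left hP)
  rw [map_mul, map_mul, hω.aeval_qIntPoly_succ hm (dvd_mul_right m j), one_mul] at h
  have h1 : aeval ω (gauss (m * j + 1 + b) (m * j)) = (j + 1 + c).choose j := by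
    rw [← hb, hω.aeval_gauss_mul hm]
  have h2 : aeval ω (gauss (m * j + b) (m * j)) = (j + c).choose j := by
    have := hω.aeval_gauss hm (j + c) j (b := m - 1) (i := 0) (by omega) (by omega)
    rw [gauss_zero_right, map_one, mul_one] at this
    rw [← this, add_zero]
    congr 2
    have : m * (j + 1 + c) = m * (j + c) + m := by ring
    omega
  rw [h, h1, h2, show j + 1 + c - 1 = j + c by omega]
  push_cast
  rfl

theorem IsPrimitiveRoot.aeval_qNarayana_eq_zero (hω : IsPrimitiveRoot ω m) (hm : 1 < m)
    {r k : ℕ} (hk : k + 1 ≤ m * r) (h0 : ¬ m ∣ k) (h1 : ¬ m ∣ k + 1) {P : ℕ[X]}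
    (hP : toRatFunc P = qNarayana (m * r) (k + 1)) : aeval ω P = 0 := by
  obtain ⟨b, hb⟩ : ∃ b, m * r = k + 1 + b := ⟨m * r - (k + 1), by omega⟩
  rw [hb] at hP
  have h := congrArg (aeval ω) (qIntPoly_mul_left hP)
  rw [map_mul, map_mul, ← hb, hω.aeval_gauss_mul_of_not_dvd hm r h0, zero_mul] at h
  exact (mul_eq_zero.1 h).resolve_left (hω.aeval_qIntPoly_ne_zero h1)

end RootOfUnity

/-! ### Walks on `ℤ` and the stack discipline -/

/-- For a walk `H` with down-steps of size one, `p` is the time at which the slot used at time `x`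
was pushed on the stack. -/
def IsOpener (H : ℤ → ℤ) (p x : ℤ) : Prop :=
  p ≤ x ∧ H p ≤ H (x + 1) ∧ ∀ t, p < t → t ≤ x → H (x + 1) < H t

/-- Two times are related if their slots were pushed at the same time. -/
def openerSetoid (H : ℤ → ℤ) : Setoid ℤ := Setoid.ker fun x => {p | IsOpener H p x}

theorem openerSetoid_iff {H : ℤ → ℤ} {x y : ℤ} :
    openerSetoid H x y ↔ ∀ p, IsOpener H p x ↔ IsOpener H p y := by
  change {p | IsOpener H p x} = {p | IsOpener H p y} ↔ _
  simp [Set.ext_iff]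

/-- A walk whose down-steps have size at most one and which drifts down by `δ` in each period. -/
structure IsPeriodicWalk (r : ℕ) (δ : ℤ) (H : ℤ → ℤ) : Prop where
  pred_le : ∀ x, H x - 1 ≤ H (x + 1)
  add_period : ∀ x, H (x + r) = H x - δ
  drift_nonneg : 0 ≤ δ

theorem IsOpener.unique {H : ℤ → ℤ} {p q x : ℤ} (hp : IsOpener H p x) (hq : IsOpener H q x) :
    p = q := by
  by_contra hne
  rcases lt_or_gt_of_ne hne with h | h
  · exact absurd (hp.2.2 q h hq.1) (not_lt.2 hq.2.1)
  · exact absurd (hq.2.2 p h hp.1) (not_lt.2 hp.2.1)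

theorem IsOpener.rel {H : ℤ → ℤ} {p x y : ℤ} (hx : IsOpener H p x) (hy : IsOpener H p y) :
    openerSetoid H x y :=
  openerSetoid_iff.2 fun _ => ⟨fun hq => (hx.unique hq) ▸ hy, fun hq => (hy.unique hq) ▸ hx⟩

theorem exists_isOpener {H : ℤ → ℤ} {t x : ℤ} (htx : t ≤ x) (h : H t ≤ H (x + 1)) :
    ∃ p, t ≤ p ∧ IsOpener H p x := by
  obtain ⟨p, ⟨hpx, hp⟩, hmax⟩ := Int.exists_greatest_of_bdd
    (P := fun u => u ≤ x ∧ H u ≤ H (x + 1)) ⟨x, fun u hu => hu.1⟩ ⟨t, htx, h⟩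
  refine ⟨p, hmax t ⟨htx, h⟩, hpx, hp, fun u hpu hux => ?_⟩
  by_contra hle
  exact absurd (hmax u ⟨hux, not_lt.1 hle⟩) (not_le.2 hpu)

theorem IsOpener.self {H : ℤ → ℤ} {p x : ℤ} (h : IsOpener H p x) : IsOpener H p p := by
  refine ⟨le_rfl, ?_, fun t h1 h2 => by omega⟩
  rcases h.1.eq_or_lt with rfl | hlt
  · exact h.2.1
  · exact h.2.1.trans (h.2.2 (p + 1) (by omega) (by omega)).le

namespace IsPeriodicWalk

variable {r : ℕ} {δ : ℤ} {H : ℤ → ℤ}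

theorem isOpener_add (hH : IsPeriodicWalk r δ H) {p x : ℤ} :
    IsOpener H (p + r) (x + r) ↔ IsOpener H p x := by
  have hx : H (x + r + 1) = H (x + 1) - δ := by rw [← hH.add_period]; congr 1; ring
  constructor
  · rintro ⟨h1, h2, h3⟩
    refine ⟨by omega, ?_, fun t ht1 ht2 => ?_⟩
    · rw [hx, hH.add_period] at h2; omega
    · have := h3 (t + r) (by omega) (by omega)
      rw [hx, hH.add_period] at this; omega
  · rintro ⟨h1, h2, h3⟩
    refine ⟨by omega, ?_, fun t ht1 ht2 => ?_⟩
    · rw [hx, hH.add_period]; omega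
    · have := h3 (t - r) (by omega) (by omega)
      have h4 := hH.add_period (t - r)
      rw [sub_add_cancel] at h4
      rw [hx, h4]; omega

/-- After one period the walk is back at or below H p, so a slot pushed at p has been popped by
then. -/
theorem lt_add_of_isOpener (hH : IsPeriodicWalk r δ H) (hr : 0 < r) {p x : ℤ}
    (h : IsOpener H p x) : x < p + r := by
  by_contra hle
  have h1 := h.2.2 (p + r) (by omega) (by omega)
  have h2 := h.2.1
  have h3 := hH.drift_nonneg
  rw [hH.add_period] at h1
  omega

/-- A common opener of x and x + r would lie at most at x and more than x in the past of x + r by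
less than r, which is impossible. So the class invariant under translation consists of the times
that find nothing to pop. -/
theorem rel_add_iff (hH : IsPeriodicWalk r δ H) (hr : 0 < r) {x : ℤ} :
    openerSetoid H x (x + r) ↔ ∀ p, ¬ IsOpener H p x := by
  constructor
  · intro h p hp
    have h1 := hH.lt_add_of_isOpener hr ((openerSetoid_iff.1 h p).1 hp)
    have := hp.1
    omega
  · intro h
    refine openerSetoid_iff.2 fun p => iff_of_false (h p) fun hp => ?_
    refine h (p - r) ?_
    rw [← hH.isOpener_add, sub_add_cancel]
    exact hp

theorem isOpener_self_iff (hH : IsPeriodicWalk r δ H) (hr : 0 < r) {x : ℤ} : IsOpener H x x ↔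
    ¬ openerSetoid H x (x + r) ∧ ∀ t < x, ¬ openerSetoid H t x := by
  rw [hH.rel_add_iff hr]
  constructor
  · refine fun h => ⟨fun h' => h' x h, fun t ht htx => ?_⟩
    have := ((openerSetoid_iff.1 htx x).2 h).1
    omega
  · rintro ⟨h1, h2⟩
    push Not at h1
    obtain ⟨p, hp⟩ := h1
    rcases hp.1.eq_or_lt with rfl | hlt
    · exact hp
    · exact absurd (hp.self.rel hp) (h2 p hlt)

/-- Time x pushes slots at the levels H x, …, H (x + 1), and a slot at level l is popped by the time
y with H (y + 1) = l; thus y ↦ H (y + 1) is a bijection. -/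
theorem card_isOpener (hH : IsPeriodicWalk r δ H) (hr : 0 < r) (x : ℤ)
    [DecidablePred (IsOpener H x)] :
    (({y ∈ Finset.Ico x (x + r) | IsOpener H x y} : Finset ℤ).card : ℤ) =
      H (x + 1) - H x + 1 := by
  have hx := hH.pred_le x
  have : ({y ∈ Finset.Ico x (x + r) | IsOpener H x y} : Finset ℤ).card =
      (Finset.Ico (H x) (H (x + 1) + 1)).card := by
    refine Finset.card_bij (fun y _ => H (y + 1)) ?_ ?_ ?_
    · intro y hy
      obtain ⟨_, h⟩ := Finset.mem_filter.1 hy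
      rw [Finset.mem_Ico]
      refine ⟨h.2.1, ?_⟩
      rcases h.1.eq_or_lt with rfl | hlt
      · omega
      · have := h.2.2 (x + 1) (by omega) (by omega)
        omega
    · intro y hy z hz hyz
      obtain ⟨_, h⟩ := Finset.mem_filter.1 hy
      obtain ⟨_, h'⟩ := Finset.mem_filter.1 hz
      have := h.1
      have := h'.1
      by_contra hne
      rcases lt_or_gt_of_ne hne with hlt | hlt
      · have := h'.2.2 (y + 1) (by omega) (by omega)
        omega
      · have := h.2.2 (z + 1) (by omega) (by omega)
        omega
    · intro l hl
      rw [Finset.mem_Ico] at hl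
      have hend : H (x + r - 1 + 1) ≤ l := by
        rw [sub_add_cancel, hH.add_period]
        have := hH.drift_nonneg
        omega
      -- The first descent to level l; down-steps of size at most one make the walk hit l exactly.
      obtain ⟨y, ⟨hxy, hy⟩, hmin⟩ := Int.exists_least_of_bdd
        (P := fun u => x ≤ u ∧ H (u + 1) ≤ l) ⟨x, fun u hu => hu.1⟩
        ⟨x + r - 1, by omega, hend⟩
      have hyr := hmin (x + r - 1) ⟨by omega, hend⟩
      have hgt : ∀ t, x < t → t ≤ y → l < H t := by
        intro t h1 h2
        by_contra hle
        have := hmin (t - 1) ⟨by omega, by rw [sub_add_cancel]; omega⟩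
        omega
      have heq : H (y + 1) = l := by
        rcases hxy.eq_or_lt with rfl | hlt
        · omega
        · have := hgt y hlt le_rfl
          have := hH.pred_le y
          omega
      refine ⟨y, ?_, heq⟩
      rw [Finset.mem_filter, Finset.mem_Ico]
      exact ⟨⟨hxy, by omega⟩, hxy, by omega, by rw [heq]; exact hgt⟩
  rw [this, Int.card_Ico]
  omega

end IsPeriodicWalk

/-! ### Periodic noncrossing equivalence relations on `ℤ` -/

/-- An equivalence relation on `ℤ` invariant under translation by `r`. -/
structure IsShiftInvariant (r : ℕ) (R : Setoid ℤ) : Prop where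
  add_iff : ∀ x y, R (x + r) (y + r) ↔ R x y

/-- An `r`-periodic noncrossing equivalence relation on `ℤ` in which every class meeting two
different periods is invariant under translation by `r`. -/
structure IsPeriodicNoncrossing (r : ℕ) (R : Setoid ℤ) : Prop extends IsShiftInvariant r R where
  noncrossing : ∀ a b c d, a < b → b < c → c < d → R a c → R b d → R a b
  central_of_le : ∀ x y, R x y → x + r ≤ y → R x (x + r)

/-- While the slot popped at c is waiting, everything popped in between was pushed no earlier. If b
were opened strictly later than a, its remaining slots would be gone before c, so d could not share
its opener. -/
theorem IsPeriodicWalk.isPeriodicNoncrossing {r : ℕ} {δ : ℤ} {H : ℤ → ℤ}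
    (hH : IsPeriodicWalk r δ H) (hr : 0 < r) : IsPeriodicNoncrossing r (openerSetoid H) := by
  refine ⟨⟨fun x y => ?_⟩, fun a b c d hab hbc hcd hac hbd => ?_, fun x y hxy hle => ?_⟩
  · rw [openerSetoid_iff, openerSetoid_iff]
    constructor
    · intro h p
      rw [← hH.isOpener_add, h, hH.isOpener_add]
    · intro h p
      have := h (p - r)
      rwa [← hH.isOpener_add, ← hH.isOpener_add (x := y), sub_add_cancel] at this
  · by_cases ha : ∃ p, IsOpener H p a
    · obtain ⟨p, hpa⟩ := ha
      have hpc := (openerSetoid_iff.1 hac p).1 hpa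
      have hpa1 := hpa.1
      have h1 : H p ≤ H (b + 1) :=
        hpc.2.1.trans (hpc.2.2 (b + 1) (by omega) (by omega)).le
      obtain ⟨q, hpq, hqb⟩ := exists_isOpener (by omega) h1
      have hqd := (openerSetoid_iff.1 hbd q).1 hqb
      rcases hpq.eq_or_lt with rfl | hlt
      · exact hpa.rel hqb
      · have h2 := hpc.2.2 q hlt (by have := hqb.1; omega)
        have h3 := hqd.2.2 (c + 1) (by have := hqb.1; omega) (by omega)
        have h4 := hqd.2.1
        omega
    · push Not at ha
      have hc : ∀ p, ¬ IsOpener H p c := fun p hp => ha p ((openerSetoid_iff.1 hac p).2 hp)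
      refine openerSetoid_iff.2 fun q => iff_of_false (ha q) fun hqb => ?_
      have hqd := (openerSetoid_iff.1 hbd q).1 hqb
      have hq := hqb.1
      have h3 := hqd.2.2 (c + 1) (by omega) (by omega)
      have h4 := hqd.2.1
      obtain ⟨p, _, hp⟩ := exists_isOpener (H := H) (t := q) (x := c) (by omega) (by omega)
      exact hc p hp
  · rw [hH.rel_add_iff hr]
    intro p hp
    have h1 := hH.lt_add_of_isOpener hr ((openerSetoid_iff.1 hxy p).1 hp)
    have := hp.1
    omega

/-- `x` is the smallest element of its class, and this class is not invariant under translation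
by `r`. -/
def IsClassMin (R : Setoid ℤ) (r : ℕ) (x : ℤ) : Prop :=
  ¬ R x (x + r) ∧ ∀ t < x, ¬ R t x

open Classical in
/-- The size of the class of `x`, recorded at the smallest element of the class. -/
noncomputable def classSize (R : Setoid ℤ) (r : ℕ) (x : ℤ) : ℕ :=
  if IsClassMin R r x then ({y ∈ Finset.Ico x (x + r) | R x y} : Finset ℤ).card else 0

theorem classSize_ne_zero_iff {R : Setoid ℤ} {r : ℕ} (hr : 0 < r) {x : ℤ} :
    classSize R r x ≠ 0 ↔ IsClassMin R r x := by
  rw [classSize]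
  split_ifs with h
  · refine iff_of_true (Finset.card_ne_zero.2 ⟨x, ?_⟩) h
    simp [hr]
  · simp [h]

/-- If x opens itself this is `card_isOpener`. Otherwise the walk goes down at x, by exactly one,
and both sides are 0. -/
theorem IsPeriodicWalk.classSize_openerSetoid {r : ℕ} {δ : ℤ} {H : ℤ → ℤ}
    (hH : IsPeriodicWalk r δ H) (hr : 0 < r) (x : ℤ) :
    (classSize (openerSetoid H) r x : ℤ) = H (x + 1) - H x + 1 := by
  classical
  have hx := hH.pred_le x
  rw [classSize, IsClassMin, ← hH.isOpener_self_iff hr]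
  split_ifs with h
  · rw [← hH.card_isOpener hr]
    congr 2
    ext y
    simp only [Finset.mem_filter, and_congr_right_iff]
    exact fun _ => ⟨fun hxy => (openerSetoid_iff.1 hxy x).1 h, fun hy => h.rel hy⟩
  · have : ¬ H x ≤ H (x + 1) := fun hle => h ⟨le_rfl, hle, fun t h1 h2 => by omega⟩
    push_cast
    omega

namespace IsShiftInvariant

variable {r : ℕ} {R : Setoid ℤ}

theorem add_mul_iff (hR : IsShiftInvariant r R) (a x y : ℤ) :
    R (x + r * a) (y + r * a) ↔ R x y := by
  induction a using Int.induction_on with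
  | zero => simp
  | succ i ih =>
    rw [← ih, ← hR.add_iff (x + r * i)]
    ring_nf
  | pred i ih =>
    rw [← ih, ← hR.add_iff (x + r * (-i - 1))]
    ring_nf

theorem central_add_mul_iff (hR : IsShiftInvariant r R) (a x : ℤ) :
    R (x + r * a) (x + r * a + r) ↔ R x (x + r) := by
  rw [← hR.add_mul_iff a x]
  ring_nf

theorem rel_add_mul (hR : IsShiftInvariant r R) {x : ℤ} (hx : R x (x + r)) (a : ℤ) :
    R x (x + r * a) := by
  induction a using Int.induction_on with
  | zero => simp
  | succ i ih =>
    have := (hR.central_add_mul_iff i x).2 hx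
    convert R.trans ih this using 1
    ring
  | pred i ih =>
    have := (hR.central_add_mul_iff (-i - 1) x).2 hx
    refine R.trans ih (R.symm ?_)
    convert this using 1
    ring

theorem central_of_rel (hR : IsShiftInvariant r R) {x y : ℤ} (hxy : R x y)
    (hx : R x (x + r)) : R y (y + r) :=
  R.trans (R.symm hxy) (R.trans hx ((hR.add_iff x y).2 hxy))

/-- Translate y to z in [x, x + r). If z ≠ x, the pairs x, x + r and z, z + r cross. The noncrossing
hypothesis is restricted to short windows so that cyclic relations satisfy it too. -/
theorem rel_of_central (hR : IsShiftInvariant r R) (hr : 0 < r)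
    (hnc : ∀ a b c d : ℤ, a < b → b < c → c < d → d < a + r + r → R a c → R b d → R a b) {x y : ℤ}
    (hx : R x (x + r)) (hy : R y (y + r)) : R x y := by
  have h1 := Int.emod_nonneg (y - x) (b := (r : ℤ)) (by omega)
  have h2 := Int.emod_lt_of_pos (y - x) (b := (r : ℤ)) (by omega)
  have h3 := Int.emod_add_mul_ediv (y - x) r
  set z := y + r * (-((y - x) / r)) with hz
  have hzx : z = x + (y - x) % r := by rw [hz]; linarith
  have hyz : R y z := hR.rel_add_mul hy _
  have hzc : R z (z + r) := hR.central_of_rel hyz hy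
  refine R.trans ?_ (R.symm hyz)
  rcases h1.eq_or_lt with h | h
  · rw [hzx, ← h, add_zero]
  · exact hnc x z (x + r) (z + r) (by omega) (by omega) (by omega) (by omega) hx hzc

end IsShiftInvariant

namespace IsPeriodicNoncrossing

variable {r : ℕ} {R : Setoid ℤ}

theorem rel_of_central (hR : IsPeriodicNoncrossing r R) (hr : 0 < r) {x y : ℤ}
    (hx : R x (x + r)) (hy : R y (y + r)) : R x y :=
  hR.toIsShiftInvariant.rel_of_central hr
    (fun a b c d h1 h2 h3 _ => hR.noncrossing a b c d h1 h2 h3) hx hy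

theorem lt_add_of_rel (hR : IsPeriodicNoncrossing r R) {x y : ℤ} (hxy : R x y)
    (hx : ¬ R x (x + r)) : y < x + r := by
  by_contra h
  exact hx (hR.central_of_le x y hxy (not_lt.1 h))

theorem exists_isClassMin (hR : IsPeriodicNoncrossing r R) {x : ℤ} (hx : ¬ R x (x + r)) :
    ∃ p ≤ x, R p x ∧ IsClassMin R r p := by
  obtain ⟨p, hp, hmin⟩ := Int.exists_least_of_bdd (P := fun t => R t x)
    ⟨x - r, fun t ht => by
      by_contra h
      exact hx (hR.central_of_rel ht (hR.central_of_le t x ht (by omega)))⟩ ⟨x, R.refl x⟩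
  exact ⟨p, hmin x (R.refl x), hp, fun h => hx (hR.central_of_rel hp h),
    fun t ht htp => absurd (hmin t (R.trans htp hp)) (not_le.2 ht)⟩

theorem isClassMin_add_mul_iff (hR : IsPeriodicNoncrossing r R) (a x : ℤ) :
    IsClassMin R r (x + r * a) ↔ IsClassMin R r x := by
  rw [IsClassMin, IsClassMin, hR.central_add_mul_iff]
  refine and_congr_right fun _ => ⟨fun h t ht htx => ?_, fun h t ht htx => ?_⟩
  · exact h (t + r * a) (by omega) ((hR.add_mul_iff a t x).2 htx)
  · refine h (t - r * a) (by omega) ((hR.add_mul_iff a _ _).1 ?_)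
    rwa [sub_add_cancel]

theorem classSize_add_mul (hR : IsPeriodicNoncrossing r R) (a x : ℤ) :
    classSize R r (x + r * a) = classSize R r x := by
  classical
  simp only [classSize, hR.isClassMin_add_mul_iff]
  split_ifs with h
  · refine (Finset.card_bij (fun y _ => y + r * a) ?_ ?_ ?_).symm
    · intro y hy
      simp only [Finset.mem_filter, Finset.mem_Ico] at hy ⊢
      exact ⟨by omega, (hR.add_mul_iff a x y).2 hy.2⟩
    · intro y _ z _ hyz
      exact add_right_cancel hyz
    · intro y hy
      simp only [Finset.mem_filter, Finset.mem_Ico] at hy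
      refine ⟨y - r * a, ?_, sub_add_cancel _ _⟩
      simp only [Finset.mem_filter, Finset.mem_Ico]
      refine ⟨by omega, (hR.add_mul_iff a x _).1 ?_⟩
      rw [sub_add_cancel]
      exact hy.2
  · rfl

theorem isClassMin_unique {p q x : ℤ} (hp : IsClassMin R r p) (hq : IsClassMin R r q)
    (hpx : R p x) (hqx : R q x) : p = q := by
  by_contra hne
  rcases lt_or_gt_of_ne hne with h | h
  · exact hq.2 p h (R.trans hpx (R.symm hqx))
  · exact hp.2 q h (R.trans hqx (R.symm hpx))

/-- The classes that open in [a, b) are disjoint and contained in [a, c). -/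
theorem sum_classSize_le {a b c : ℤ} (h : ∀ u, a ≤ u → u < b → IsClassMin R r u →
    ∀ y, u ≤ y → y < u + r → R u y → y < c) (hac : a ≤ c) :
    (∑ u ∈ Finset.Ico a b, (classSize R r u : ℤ)) ≤ c - a := by
  classical
  set T := (Finset.Ico a b).filter (IsClassMin R r) with hT
  have h1 : ∑ u ∈ Finset.Ico a b, classSize R r u =
      ∑ u ∈ T, ({y ∈ Finset.Ico u (u + r) | R u y} : Finset ℤ).card := by
    rw [hT, Finset.sum_filter]
    rfl
  rw [← Nat.cast_sum, h1, ← Finset.card_biUnion]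
  · have : (T.biUnion fun u => {y ∈ Finset.Ico u (u + r) | R u y}).card ≤
        (Finset.Ico a c).card := by
      refine Finset.card_le_card fun y hy => ?_
      simp only [hT, Finset.mem_biUnion, Finset.mem_filter, Finset.mem_Ico] at hy ⊢
      obtain ⟨u, ⟨⟨hau, hub⟩, hu⟩, ⟨huy, hyu⟩, hr⟩ := hy
      exact ⟨by omega, h u hau hub hu y huy hyu hr⟩
    rw [Int.card_Ico] at this
    omega
  · intro u hu v hv huv
    rw [Function.onFun, Finset.disjoint_left]
    intro y hy hy'
    simp only [hT, Finset.mem_coe, Finset.mem_filter] at hu hv hy hy'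
    exact huv (isClassMin_unique hu.2 hv.2 hy.2 hy'.2)

/-- The classes that open in [a, b) cover that interval. -/
theorem le_sum_classSize {a b : ℤ} (hR : IsPeriodicNoncrossing r R)
    (h : ∀ y, a ≤ y → y < b → ∃ u, a ≤ u ∧ u ≤ y ∧ IsClassMin R r u ∧ R u y) :
    b - a ≤ ∑ u ∈ Finset.Ico a b, (classSize R r u : ℤ) := by
  classical
  set T := (Finset.Ico a b).filter (IsClassMin R r) with hT
  have h1 : ∑ u ∈ Finset.Ico a b, classSize R r u =
      ∑ u ∈ T, ({y ∈ Finset.Ico u (u + r) | R u y} : Finset ℤ).card := by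
    rw [hT, Finset.sum_filter]
    rfl
  rw [← Nat.cast_sum, h1]
  have h2 := Finset.card_biUnion_le (s := T)
    (t := fun u => ({y ∈ Finset.Ico u (u + r) | R u y} : Finset ℤ))
  have h3 : (Finset.Ico a b).card ≤
      (T.biUnion fun u => {y ∈ Finset.Ico u (u + r) | R u y}).card := by
    refine Finset.card_le_card fun y hy => ?_
    rw [Finset.mem_Ico] at hy
    obtain ⟨u, hau, huy, hu, hr⟩ := h y hy.1 hy.2
    simp only [hT, Finset.mem_biUnion, Finset.mem_filter, Finset.mem_Ico]
    exact ⟨u, ⟨⟨hau, by omega⟩, hu⟩, ⟨huy, hR.lt_add_of_rel hr hu.1⟩, hr⟩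
  rw [Int.card_Ico] at h3
  omega

/-- The smallest elements of the classes are recovered from the walk with steps one less than
the class sizes. -/
theorem isOpener_iff (hR : IsPeriodicNoncrossing r R) {H : ℤ → ℤ}
    (hH : ∀ a b, a ≤ b → H b - H a = (∑ u ∈ Finset.Ico a b, (classSize R r u : ℤ)) - (b - a))
    {p x : ℤ} : IsOpener H p x ↔ p ≤ x ∧ IsClassMin R r p ∧ R p x := by
  -- If the classes opened in [t, x] all end before x, they fit into [t, x) and have total size at
  -- most x - t, while x + 1 - t slots are requested.
  have hdown : ∀ t ≤ x, (∀ u, t ≤ u → u ≤ x → IsClassMin R r u → ∀ y, R u y → y < x) →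
      H (x + 1) < H t := by
    intro t htx h
    have h1 := hH t (x + 1) (by omega)
    have h2 := sum_classSize_le (R := R) (r := r) (a := t) (b := x + 1) (c := x)
      (fun u h1 h2 hu y _ _ huy => h u h1 (by omega) hu y huy) htx
    omega
  have hmain : ∀ p, p ≤ x → IsClassMin R r p → R p x → IsOpener H p x := by
    intro p hpx hp hR'
    refine ⟨hpx, ?_, fun t hpt htx => hdown t htx fun u htu hux hu y huy => ?_⟩
    · have h1 := hH p (x + 1) (by omega)
      have h2 := hR.le_sum_classSize (a := p) (b := x + 1) fun y hpy hyx => by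
        by_cases hyp : R p y
        · exact ⟨p, le_rfl, hpy, hp, hyp⟩
        have hpy' : p < y := lt_of_le_of_ne hpy fun h => hyp (h ▸ R.refl _)
        have hyx' : y < x := lt_of_le_of_ne (by omega) fun h => hyp (h ▸ hR')
        -- A central y strictly between p and x would cross the pair p, x by means of y + r.
        have hyc : ¬ R y (y + r) := by
          intro hc
          have h3 : R (y + r * (-1)) y := R.symm (hR.rel_add_mul hc (-1))
          have hxr := hR.lt_add_of_rel hR' hp.1
          exact hyp (hR.noncrossing p y x (y + r) hpy' hyx' (by omega) hR' hc)
        obtain ⟨u, huy, hRu, hu⟩ := hR.exists_isClassMin hyc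
        refine ⟨u, ?_, huy, hu, hRu⟩
        by_contra hup
        have := hR.noncrossing u p y x (by omega) hpy' hyx' hRu hR'
        exact hp.2 u (by omega) this
      omega
    · by_contra hxy
      have hup : ¬ R p u := fun h => hu.2 p (by omega) h
      have hux' : u < x := lt_of_le_of_ne hux fun h => hup (h ▸ hR')
      have hxy' : x < y := lt_of_le_of_ne (by omega) fun h =>
        hup (R.trans hR' (h ▸ R.symm huy))
      exact hup (hR.noncrossing p u x y (by omega) hux' hxy' hR' huy)
  constructor
  · intro h
    by_cases hx : R x (x + r)
    -- For central x, a class opened in [p, x] that reaches x or beyond would cross the pair x - r,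
    -- x.
    · refine absurd h.2.1 (not_le.2 (hdown p h.1 fun u hpu hux hu y huy => ?_))
      by_contra hxy
      have huc : ¬ R x u := fun h' => hu.1 (hR.central_of_rel h' hx)
      have hux' : u < x := lt_of_le_of_ne hux fun h => huc (h ▸ R.refl _)
      have hxy' : x < y := lt_of_le_of_ne (by omega) fun h => huc (h ▸ R.symm huy)
      have hyu := hR.lt_add_of_rel huy hu.1
      have hxr : R x (x + r * (-1)) := hR.rel_add_mul hx (-1)
      refine huc (R.trans hxr ?_)
      exact hR.noncrossing _ u x y (by omega) hux' hxy' (R.symm hxr) huy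
    · obtain ⟨q, hqx, hRq, hq⟩ := hR.exists_isClassMin hx
      rw [h.unique (hmain q hqx hq hRq)]
      exact ⟨hqx, hq, hRq⟩
  · rintro ⟨h1, h2, h3⟩
    exact hmain p h1 h2 h3

theorem eq_openerSetoid (hR : IsPeriodicNoncrossing r R) (hr : 0 < r) {H : ℤ → ℤ}
    (hH : ∀ a b, a ≤ b → H b - H a = (∑ u ∈ Finset.Ico a b, (classSize R r u : ℤ)) - (b - a)) :
    openerSetoid H = R := by
  ext x y
  rw [openerSetoid_iff]
  simp only [hR.isOpener_iff hH]
  constructor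
  · intro h
    by_cases hx : R x (x + r)
    · by_cases hy : R y (y + r)
      · exact hR.rel_of_central hr hx hy
      · obtain ⟨p, h1, h2, h3⟩ := hR.exists_isClassMin hy
        exact R.trans (R.symm ((h p).2 ⟨h1, h3, h2⟩).2.2) h2
    · obtain ⟨p, h1, h2, h3⟩ := hR.exists_isClassMin hx
      exact R.trans (R.symm h2) ((h p).1 ⟨h1, h3, h2⟩).2.2
  · intro h p
    have aux : ∀ {x y}, R x y → p ≤ x ∧ IsClassMin R r p ∧ R p x →
        p ≤ y ∧ IsClassMin R r p ∧ R p y := by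
      rintro x y h ⟨_, h2, h3⟩
      refine ⟨?_, h2, R.trans h3 h⟩
      by_contra hlt
      exact h2.2 y (by omega) (R.trans (R.symm h) (R.symm h3))
    exact ⟨aux h, aux (R.symm h)⟩

end IsPeriodicNoncrossing

/-! ### Class sizes as functions on `ℤ/rℤ` -/

section Walk

variable {r : ℕ} (s : ZMod r → ℕ)

/-- The walk with steps `s x - 1`, normalized to vanish at `0`. -/
noncomputable def sizeWalk (x : ℤ) : ℤ :=
  ∑ t ∈ Finset.Ico 0 x, ((s t : ℤ) - 1) - ∑ t ∈ Finset.Ico x 0, ((s t : ℤ) - 1)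

theorem sizeWalk_add_one (x : ℤ) : sizeWalk s (x + 1) = sizeWalk s x + ((s x : ℤ) - 1) := by
  rcases le_or_gt 0 x with hx | hx
  · rw [sizeWalk, sizeWalk, Finset.Ico_eq_empty_of_le (a := x) (b := 0) hx,
      Finset.Ico_eq_empty_of_le (a := x + 1) (b := 0) (by omega),
      ← Finset.insert_Ico_right_eq_Ico_add_one hx, Finset.sum_insert (by simp)]
    simp
    ring
  · rw [sizeWalk, sizeWalk, Finset.Ico_eq_empty_of_le (a := 0) (b := x) hx.le,
      Finset.Ico_eq_empty_of_le (a := 0) (b := x + 1) (by omega),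
      ← Finset.insert_Ico_add_one_left_eq_Ico hx, Finset.sum_insert (by simp),
      Finset.sum_empty]
    ring

theorem sizeWalk_sub {a b : ℤ} (hab : a ≤ b) :
    sizeWalk s b - sizeWalk s a = (∑ u ∈ Finset.Ico a b, (s u : ℤ)) - (b - a) := by
  induction b, hab using Int.leInduction with
  | base => simp
  | succ b hab ih =>
    rw [← Finset.insert_Ico_right_eq_Ico_add_one hab, Finset.sum_insert (by simp),
      sizeWalk_add_one]
    linarith

theorem sum_Ico_intCast [NeZero r] {M : Type*} [AddCommMonoid M] (f : ZMod r → M) (x : ℤ) :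
    ∑ u ∈ Finset.Ico x (x + r), f u = ∑ z, f z := by
  have hr : (0 : ℤ) < r := by exact_mod_cast NeZero.pos r
  refine Finset.sum_bij (fun u _ => (u : ZMod r)) (fun _ _ => Finset.mem_univ _) ?_ ?_
    (fun _ _ => rfl)
  · intro u hu v hv huv
    rw [Finset.mem_Ico] at hu hv
    rw [ZMod.intCast_eq_intCast_iff_dvd_sub] at huv
    have := Int.eq_zero_of_abs_lt_dvd huv (by rw [abs_lt]; constructor <;> omega)
    omega
  · intro z _
    refine ⟨x + ((z.val : ℤ) - x) % r, ?_, ?_⟩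
    · have h1 := Int.emod_nonneg ((z.val : ℤ) - x) hr.ne'
      have h2 := Int.emod_lt_of_pos ((z.val : ℤ) - x) hr
      rw [Finset.mem_Ico]
      omega
    · rw [Int.cast_add, ZMod.intCast_mod]
      simp

variable {s}

theorem sizeWalk_add_period [NeZero r] (x : ℤ) :
    sizeWalk s (x + r) = sizeWalk s x - ((r : ℤ) - ∑ z, (s z : ℤ)) := by
  have h := sizeWalk_sub s (show x ≤ x + r by omega)
  rw [sum_Ico_intCast (fun z => (s z : ℤ))] at h
  linarith

theorem isPeriodicWalk_sizeWalk [NeZero r] (hs : ∑ z, s z ≤ r) :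
    IsPeriodicWalk r ((r : ℤ) - ∑ z, (s z : ℤ)) (sizeWalk s) := by
  refine ⟨fun x => ?_, sizeWalk_add_period, ?_⟩
  · rw [sizeWalk_add_one]; omega
  · rw [← Nat.cast_sum]; omega

theorem IsPeriodicWalk.add_mul {δ : ℤ} {H : ℤ → ℤ} (hH : ∀ x, H (x + r) = H x - δ) (x : ℤ)
    (N : ℕ) : H (x + r * N) = H x - N * δ := by
  induction N with
  | zero => simp
  | succ N ih =>
    rw [Nat.cast_succ, mul_add, mul_one, ← add_assoc, hH, ih]
    ring

/-- Every partial sum of `s` ending at `x` is deficient. -/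
def IsRecordLow (s : ZMod r → ℕ) (x : ℤ) : Prop :=
  ∀ t ≤ x, sizeWalk s (x + 1) < sizeWalk s t

theorem isRecordLow_iff_forall_not_isOpener {s : ZMod r → ℕ} {x : ℤ} :
    IsRecordLow s x ↔ ∀ p, ¬ IsOpener (sizeWalk s) p x := by
  constructor
  · exact fun h p hp => absurd (h p hp.1) (not_lt.2 hp.2.1)
  · intro h t ht
    by_contra hle
    obtain ⟨p, _, hp⟩ := exists_isOpener ht (not_lt.1 hle)
    exact h p hp

theorem isRecordLow_comp_add {s : ZMod r → ℕ} {a x : ℤ} :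
    IsRecordLow (fun z => s (z + (a : ZMod r))) x ↔ IsRecordLow s (x + a) := by
  have key : ∀ t ≤ x, sizeWalk (fun z => s (z + (a : ZMod r))) (x + 1) -
      sizeWalk (fun z => s (z + (a : ZMod r))) t =
      sizeWalk s (x + a + 1) - sizeWalk s (t + a) := by
    intro t ht
    rw [sizeWalk_sub _ (by omega), sizeWalk_sub _ (by omega),
      show x + a + 1 = x + 1 + a by ring,
      ← Finset.sum_Ico_add' (fun u : ℤ => (s u : ℤ)) t (x + 1) a]
    push_cast
    ring
  constructor
  · intro h t ht
    have h1 := key (t - a) (by omega)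
    have h2 := h (t - a) (by omega)
    rw [sub_add_cancel] at h1
    omega
  · intro h t ht
    have h1 := key t ht
    have h2 := h (t + a) (by omega)
    omega

end Walk

/-! ### The bijection with class sizes, and record lows -/

section Sizes

variable {r : ℕ} [NeZero r]

/-- The class sizes of a periodic relation, as a function on `ℤ/rℤ`. -/
noncomputable def periodSizes (R : Setoid ℤ) (z : ZMod r) : ℕ := classSize R r z.val

theorem IsPeriodicNoncrossing.periodSizes_intCast {R : Setoid ℤ} (hR : IsPeriodicNoncrossing r R)
    (x : ℤ) : periodSizes R (x : ZMod r) = classSize R r x := by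
  rw [periodSizes, ZMod.val_intCast, ← hR.classSize_add_mul (x / r), Int.emod_add_mul_ediv]

/-- The classes opening during r + 1 periods overhang by at most r. A sum S ≥ r + 1 would give (r +
1)² ≤ r (r + 1) + r. -/
theorem IsPeriodicNoncrossing.sum_periodSizes_le {R : Setoid ℤ} (hR : IsPeriodicNoncrossing r R) :
    ∑ z : ZMod r, periodSizes R z ≤ r := by
  have h1 := IsPeriodicWalk.add_mul (sizeWalk_add_period (s := periodSizes (r := r) R)) 0 (r + 1)
  rw [zero_add] at h1
  have h2 := sizeWalk_sub (periodSizes (r := r) R) (a := 0) (b := r * ((r + 1 : ℕ) : ℤ))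
    (by positivity)
  simp only [hR.periodSizes_intCast] at h2
  have h3 := IsPeriodicNoncrossing.sum_classSize_le (R := R) (r := r) (a := 0)
    (b := r * ((r + 1 : ℕ) : ℤ)) (c := r * ((r + 1 : ℕ) : ℤ) + r)
    (fun u _ _ _ y _ _ _ => by omega) (by positivity)
  rw [← Nat.cast_sum] at h1
  set S := ∑ z : ZMod r, periodSizes R z
  by_contra hlt
  have h4 : (r : ℤ) + 1 ≤ S := by omega
  push_cast at h1 h2 h3
  have h5 : ((r : ℤ) + 1) * S ≤ r * (r + 1) + r := by nlinarith
  nlinarith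

/-- Periodic noncrossing relations correspond to functions on `ℤ/rℤ` with sum at most `r`. -/
noncomputable def periodicNoncrossingEquiv (r : ℕ) [NeZero r] :
    {R : Setoid ℤ // IsPeriodicNoncrossing r R} ≃ {s : ZMod r → ℕ // ∑ z, s z ≤ r} where
  toFun R := ⟨periodSizes R.1, R.2.sum_periodSizes_le⟩
  invFun s := ⟨openerSetoid (sizeWalk s.1),
    (isPeriodicWalk_sizeWalk s.2).isPeriodicNoncrossing (NeZero.pos r)⟩
  left_inv R := Subtype.ext <| R.2.eq_openerSetoid (NeZero.pos r) fun a b hab => by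
    rw [sizeWalk_sub _ hab]
    simp only [R.2.periodSizes_intCast]
  right_inv s := Subtype.ext <| funext fun z => by
    have h := (isPeriodicWalk_sizeWalk s.2).classSize_openerSetoid (NeZero.pos r) z.val
    rw [sizeWalk_add_one] at h
    rw [Int.cast_natCast, ZMod.natCast_zmod_val] at h
    change classSize (openerSetoid (sizeWalk s.1)) r z.val = s.1 z
    omega

theorem IsPeriodicNoncrossing.card_support_periodSizes {R : Setoid ℤ}
    (hR : IsPeriodicNoncrossing r R) (x : ℤ) [DecidablePred (IsClassMin R r)] :
    ({z : ZMod r | periodSizes R z ≠ 0} : Finset (ZMod r)).card =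
      ({u ∈ Finset.Ico x (x + r) | IsClassMin R r u} : Finset ℤ).card := by
  rw [Finset.card_filter, Finset.card_filter,
    ← sum_Ico_intCast (fun z : ZMod r => if periodSizes R z ≠ 0 then 1 else 0) x]
  refine Finset.sum_congr rfl fun u _ => ?_
  simp only [hR.periodSizes_intCast, classSize_ne_zero_iff (NeZero.pos r)]

/-- In the relation rebuilt from the sizes, x is central exactly when it has no opener, which is a
record low of the walk. -/
theorem IsPeriodicNoncrossing.central_iff {R : Setoid ℤ} (hR : IsPeriodicNoncrossing r R)
    {x : ℤ} : R x (x + r) ↔ IsRecordLow (periodSizes (r := r) R) x := by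
  have h1 := (periodicNoncrossingEquiv r).left_inv ⟨R, hR⟩
  have h2 : openerSetoid (sizeWalk (periodSizes (r := r) R)) = R :=
    congrArg Subtype.val h1
  rw [isRecordLow_iff_forall_not_isOpener,
    ← (isPeriodicWalk_sizeWalk hR.sum_periodSizes_le).rel_add_iff (NeZero.pos r), h2]

theorem exists_isRecordLow {s : ZMod r → ℕ} (hs : ∑ z, s z < r) : ∃ x, IsRecordLow s x := by
  have hr : (0 : ℤ) < r := by exact_mod_cast NeZero.pos r
  -- The weight r + 1 encodes a lexicographic minimum: the lowest point of a period, leftmost among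
  -- ties. Positive drift makes earlier periods strictly higher.
  obtain ⟨y, hy, hmin⟩ := Finset.exists_min_image (Finset.Ioc (0 : ℤ) r)
    (fun u => sizeWalk s u * (r + 1) + u) ⟨r, Finset.mem_Ioc.2 ⟨hr, le_rfl⟩⟩
  rw [Finset.mem_Ioc] at hy
  refine ⟨y - 1, fun t ht => ?_⟩
  rw [sub_add_cancel]
  obtain ⟨N, u, hu0, hur, htu⟩ : ∃ (N : ℕ) (u : ℤ), 0 < u ∧ u ≤ r ∧ t + r * N = u := by
    have h1 := Int.emod_nonneg (t - 1) hr.ne'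
    have h2 := Int.emod_lt_of_pos (t - 1) hr
    have h3 := Int.emod_add_mul_ediv (t - 1) r
    have h4 : (t - 1) / r ≤ 0 := by
      by_contra h
      nlinarith
    obtain ⟨N, hN⟩ := Int.eq_ofNat_of_zero_le (neg_nonneg.2 h4)
    refine ⟨N, (t - 1) % r + 1, by omega, by omega, ?_⟩
    rw [← hN]
    linarith
  have h5 := IsPeriodicWalk.add_mul (sizeWalk_add_period (s := s)) t N
  have h6 := hmin u (Finset.mem_Ioc.2 ⟨hu0, hur⟩)
  rw [htu, ← Nat.cast_sum] at h5
  by_contra hlt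
  obtain _ | N := N
  · simp only [Nat.cast_zero, mul_zero, add_zero, zero_mul, sub_zero] at htu h5
    nlinarith
  · have h7 : (1 : ℤ) ≤ (r : ℤ) - (∑ z, s z : ℕ) := by omega
    have h8 : sizeWalk s u + 1 ≤ sizeWalk s y := by
      push_cast at h5
      nlinarith
    nlinarith

theorem IsRecordLow.sum_lt {s : ZMod r → ℕ} {x : ℤ} (h : IsRecordLow s x) : ∑ z, s z < r := by
  have h1 := h (x + 1 - r) (by have := NeZero.pos r; omega)
  have h2 := sizeWalk_add_period (s := s) (x + 1 - r)
  rw [sub_add_cancel, ← Nat.cast_sum] at h2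
  omega

theorem isRecordLow_add_period {s : ZMod r → ℕ} {x : ℤ} :
    IsRecordLow s (x + r) ↔ IsRecordLow s x := by
  have key : ∀ x t, sizeWalk s (x + r + 1) < sizeWalk s (t + r) ↔
      sizeWalk s (x + 1) < sizeWalk s t := fun x t => by
    rw [show x + r + 1 = x + 1 + r by ring, sizeWalk_add_period, sizeWalk_add_period]
    omega
  constructor
  · exact fun h t ht => (key x t).1 (h (t + r) (by omega))
  · intro h t ht
    have := (key x (t - r)).2 (h (t - r) (by omega))
    rwa [sub_add_cancel] at this

theorem isRecordLow_emod {s : ZMod r → ℕ} {x : ℤ} :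
    IsRecordLow s (x % r) ↔ IsRecordLow s x := by
  have key : ∀ (N : ℕ) (y : ℤ), IsRecordLow s (y + r * N) ↔ IsRecordLow s y := by
    intro N y
    induction N with
    | zero => simp
    | succ N ih =>
      rw [← ih, ← isRecordLow_add_period (x := y + r * N)]
      push_cast
      ring_nf
  have h := Int.emod_add_mul_ediv x r
  rcases le_total 0 (x / r) with h0 | h0
  · obtain ⟨N, hN⟩ := Int.eq_ofNat_of_zero_le h0
    conv_rhs => rw [← h, hN]
    exact (key N _).symm
  · obtain ⟨N, hN⟩ := Int.eq_ofNat_of_zero_le (neg_nonneg.2 h0)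
    have : x % r = x + r * N := by rw [← hN]; linarith
    rw [this]
    exact key N x

theorem isRecordLow_congr {s : ZMod r → ℕ} {x y : ℤ} (h : (x : ZMod r) = y) :
    IsRecordLow s x ↔ IsRecordLow s y := by
  rw [← isRecordLow_emod, ← isRecordLow_emod (x := y), (ZMod.intCast_eq_intCast_iff' x y r).1 h]

/-- If `s` has sum `r - 1`, its record lows form a single residue class. -/
theorem IsRecordLow.eq_of_sum {s : ZMod r → ℕ} (hs : ∑ z, s z + 1 = r) {x y : ℤ}
    (hx : IsRecordLow s x) (hy : IsRecordLow s y) : (x : ZMod r) = y := by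
  have hr : (0 : ℤ) < r := by exact_mod_cast NeZero.pos r
  set z := x + (y - x) % r with hz
  have h1 := Int.emod_nonneg (y - x) hr.ne'
  have h2 := Int.emod_lt_of_pos (y - x) hr
  have hzy : (z : ZMod r) = y := by
    rw [hz, Int.cast_add, ZMod.intCast_mod]
    simp
  replace hy := (isRecordLow_congr hzy).2 hy
  rw [← hzy]
  by_contra hne
  have hxz : x < z := lt_of_le_of_ne (by omega) fun h => hne (by rw [← h])
  -- Two record lows within one period would force a descent of at least 2, but the drift is 1.
  have h3 := hy (x + 1) (by omega)
  have h4 := isRecordLow_add_period.2 hx (z + 1) (by omega)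
  have h5 := sizeWalk_add_period (s := s) (x + 1)
  rw [← Nat.cast_sum] at h5
  rw [show x + r + 1 = x + 1 + r by ring] at h4
  omega

/-- If the record lows of `s` form a single residue class, then `s` has sum `r - 1`. -/
theorem IsRecordLow.sum_eq {s : ZMod r → ℕ} {x : ℤ} (hx : IsRecordLow s x)
    (h : ∀ y, IsRecordLow s y → (x : ZMod r) = y) : ∑ z, s z + 1 = r := by
  have h0 := hx.sum_lt
  by_contra hne
  have h5 := sizeWalk_add_period (s := s) (x + 1)
  rw [← Nat.cast_sum] at h5
  -- Here the drift is at least 2, so the walk passes below H (x + 1) before the period ends; the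
  -- first such time is another record low, in a different residue class.
  have hend : sizeWalk s (x + r - 1 + 1) < sizeWalk s (x + 1) := by
    have := sizeWalk_add_one s (x + r)
    rw [show x + r + 1 = x + 1 + r by ring] at this
    rw [sub_add_cancel]
    omega
  have hlast : x < x + r - 1 := by
    by_contra hle
    have : (r : ℤ) = 1 := by have := NeZero.pos r; omega
    rw [this, add_sub_cancel_right] at hend
    exact lt_irrefl _ hend
  obtain ⟨y, ⟨hxy, hy⟩, hmin⟩ := Int.exists_least_of_bdd
    (P := fun u => x < u ∧ sizeWalk s (u + 1) < sizeWalk s (x + 1)) ⟨x, fun u hu => hu.1.le⟩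
    ⟨x + r - 1, hlast, hend⟩
  have hyr : y ≤ x + r - 1 := hmin _ ⟨hlast, hend⟩
  have hrec : IsRecordLow s y := by
    intro t ht
    rcases le_or_gt t x with htx | htx
    · exact hy.trans (hx t htx)
    rcases (show x + 1 ≤ t by omega).eq_or_lt with rfl | hlt
    · exact hy
    · by_contra hle
      have := hmin (t - 1) ⟨by omega, by rw [sub_add_cancel]; omega⟩
      omega
  have := h y hrec
  rw [ZMod.intCast_eq_intCast_iff_dvd_sub] at this
  have := Int.le_of_dvd (by omega) this
  omega

end Sizes

/-! ### Counting functions with given sum and support size -/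

section Counting

variable {ι : Type*} [Fintype ι] [DecidableEq ι]

/-- The functions `ι → ℕ` with sum `N` and support of size `j`. -/
def sumSupport (ι : Type*) [Fintype ι] [DecidableEq ι] (N j : ℕ) : Finset (ι → ℕ) :=
  {s ∈ Finset.piAntidiag Finset.univ N | ({z | s z ≠ 0} : Finset ι).card = j}

theorem mem_sumSupport {N j : ℕ} {s : ι → ℕ} :
    s ∈ sumSupport ι N j ↔ ∑ z, s z = N ∧ ({z | s z ≠ 0} : Finset ι).card = j := by
  simp [sumSupport]

/-- Subtracting 1 on the prescribed support T leaves an arbitrary function on T with sum N - |T|. -/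
theorem card_support_eq (T : Finset ι) {N : ℕ} (hN : T.card ≤ N) :
    ({s ∈ Finset.piAntidiag Finset.univ N | ({z | s z ≠ 0} : Finset ι) = T} :
      Finset (ι → ℕ)).card = T.card.multichoose (N - T.card) := by
  rw [← Finset.card_finsuppAntidiag_nat_eq_multichoose]
  symm
  refine Finset.card_bij (fun f _ z => if z ∈ T then f z + 1 else 0) ?_ ?_ ?_
  · intro f hf
    rw [Finset.mem_finsuppAntidiag] at hf
    simp only [Finset.mem_filter, Finset.mem_piAntidiag, Finset.mem_univ, implies_true, and_true]
    constructor
    · rw [Finset.sum_ite_mem, Finset.univ_inter, Finset.sum_add_distrib, hf.1]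
      simp
      omega
    · ext z
      simp
  · intro f hf g hg hfg
    rw [Finset.mem_finsuppAntidiag] at hf hg
    ext z
    have h := congrFun hfg z
    by_cases hz : z ∈ T
    · simpa [hz] using h
    · rw [Finsupp.notMem_support_iff.1 fun h => hz (hf.2 h),
        Finsupp.notMem_support_iff.1 fun h => hz (hg.2 h)]
  · intro s hs
    simp only [Finset.mem_filter, Finset.mem_piAntidiag, Finset.mem_univ, implies_true,
      and_true] at hs
    obtain ⟨hsum, rfl⟩ := hs
    refine ⟨Finsupp.onFinset {z | s z ≠ 0} (fun z => s z - 1) ?_, ?_, ?_⟩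
    · intro z hz
      simp only [Finset.mem_filter, Finset.mem_univ, true_and]
      omega
    · rw [Finset.mem_finsuppAntidiag]
      refine ⟨?_, Finsupp.support_onFinset_subset⟩
      have h1 : ∑ z ∈ ({z | s z ≠ 0} : Finset ι), (s z - 1) +
          ({z | s z ≠ 0} : Finset ι).card = ∑ z, s z := by
        rw [Finset.card_eq_sum_ones, ← Finset.sum_add_distrib, Finset.sum_filter]
        refine Finset.sum_congr rfl fun z _ => ?_
        split_ifs <;> omega
      change ∑ z ∈ ({z | s z ≠ 0} : Finset ι), (s z - 1) = _
      have h2 : ∑ z, s z = N := hsum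
      omega
    · funext z
      simp only [Finset.mem_filter, Finset.mem_univ, true_and, Finsupp.onFinset_apply]
      split_ifs <;> omega

/-- Choose the support, then a composition of N + 1 into j + 1 positive parts. -/
theorem card_sumSupport (N j : ℕ) : (sumSupport ι (N + 1) (j + 1)).card =
    (Fintype.card ι).choose (j + 1) * N.choose j := by
  have h1 : (sumSupport ι (N + 1) (j + 1)).card =
      ∑ T ∈ Finset.powersetCard (j + 1) (Finset.univ : Finset ι),
        ({s ∈ Finset.piAntidiag Finset.univ (N + 1) | ({z | s z ≠ 0} : Finset ι) = T} :
          Finset (ι → ℕ)).card := by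
    rw [Finset.card_eq_sum_card_fiberwise (f := fun s : ι → ℕ => ({z | s z ≠ 0} : Finset ι))
      (t := Finset.powersetCard (j + 1) Finset.univ)]
    · refine Finset.sum_congr rfl fun T hT => ?_
      rw [Finset.mem_powersetCard_univ] at hT
      rw [sumSupport, Finset.filter_filter]
      congr 1
      ext s
      simp only [Finset.mem_filter, and_congr_right_iff, and_iff_right_iff_imp]
      rintro _ rfl
      exact hT
    · intro s hs
      rw [Finset.mem_coe, mem_sumSupport] at hs
      rw [Finset.mem_coe, Finset.mem_powersetCard_univ]
      exact hs.2
  rw [h1, Finset.sum_congr rfl (g := fun _ => N.choose j), Finset.sum_const,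
    Finset.card_powersetCard, smul_eq_mul, Finset.card_univ]
  intro T hT
  rw [Finset.mem_powersetCard_univ] at hT
  rcases le_or_gt (j + 1) (N + 1) with h | h
  · rw [card_support_eq T (by omega), hT, Nat.multichoose_eq,
      show j + 1 + (N + 1 - (j + 1)) - 1 = N by omega, ← Nat.choose_symm_of_eq_add]
    omega
  · rw [Nat.choose_eq_zero_of_lt (by omega), Finset.card_eq_zero, Finset.filter_eq_empty_iff]
    intro s hs hsT
    simp only [Finset.mem_piAntidiag, Finset.mem_univ, implies_true, and_true] at hs
    have h2 : T.card ≤ Finset.univ.sum s := by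
      rw [← hsT, Finset.card_eq_sum_ones, Finset.sum_filter]
      refine Finset.sum_le_sum fun z _ => ?_
      split_ifs <;> omega
    omega

theorem card_sumSupport_zero_left (j : ℕ) :
    (sumSupport ι 0 j).card = if j = 0 then 1 else 0 := by
  split_ifs with h
  · subst h
    rw [Finset.card_eq_one]
    refine ⟨0, ?_⟩
    ext s
    rw [mem_sumSupport, Finset.mem_singleton]
    simp [funext_iff]
  · rw [Finset.card_eq_zero, Finset.eq_empty_iff_forall_notMem]
    intro s hs
    rw [mem_sumSupport] at hs
    have h1 : ∀ z, s z = 0 := by simpa using hs.1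
    simp [h1] at hs
    omega

theorem card_sumSupport_zero_right (N : ℕ) : (sumSupport ι (N + 1) 0).card = 0 := by
  rw [Finset.card_eq_zero, Finset.eq_empty_iff_forall_notMem]
  intro s hs
  rw [mem_sumSupport, Finset.card_eq_zero, Finset.filter_eq_empty_iff] at hs
  have h1 : ∀ z, s z = 0 := by simpa using hs.2
  simp [h1] at hs

theorem sum_card_sumSupport (M j : ℕ) : ∑ N ∈ Finset.range (M + 1), (sumSupport ι N j).card =
    (Fintype.card ι).choose j * M.choose j := by
  induction M with
  | zero =>
    rw [Finset.sum_range_one, card_sumSupport_zero_left]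
    cases j <;> simp
  | succ M ih =>
    rw [Finset.sum_range_succ, ih]
    cases j with
    | zero => simp [card_sumSupport_zero_right]
    | succ j => rw [card_sumSupport, Nat.choose_succ_succ M j]; ring

/-- The cycle lemma: among the functions on `ℤ/rℤ` with sum `r - 1`, each orbit under translation
contains equally many functions for each position of the record low. -/
theorem mul_card_isRecordLow_zero (n k : ℕ) [DecidablePred fun s : ZMod (n + 1) → ℕ =>
    IsRecordLow s 0] : (n + 1) * ({s ∈ sumSupport (ZMod (n + 1)) n k | IsRecordLow s 0} :
      Finset (ZMod (n + 1) → ℕ)).card = (sumSupport (ZMod (n + 1)) n k).card := by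
  have hmem : ∀ (s : ZMod (n + 1) → ℕ) (a : ZMod (n + 1)), s ∈ sumSupport (ZMod (n + 1)) n k →
      (fun z => s (z + a)) ∈ sumSupport (ZMod (n + 1)) n k := by
    intro s a hs
    rw [mem_sumSupport] at hs ⊢
    constructor
    · exact (Equiv.sum_comp (Equiv.addRight a) s).trans hs.1
    · rw [← hs.2, Finset.card_filter, Finset.card_filter]
      exact Equiv.sum_comp (Equiv.addRight a) fun z => if s z ≠ 0 then 1 else 0
  have hcard : n + 1 = (Finset.univ : Finset (ZMod (n + 1))).card := by
    rw [Finset.card_univ, ZMod.card]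
  refine (congrArg (· * _) hcard).trans ?_
  rw [mul_comm, ← Finset.card_product]
  refine Finset.card_bij (fun p _ z => p.1 (z + p.2)) ?_ ?_ ?_
  · rintro ⟨s, a⟩ h
    simp only [Finset.mem_product, Finset.mem_filter] at h
    exact hmem s a h.1.1
  · rintro ⟨s, a⟩ h ⟨t, b⟩ h' heq
    simp only [Finset.mem_product, Finset.mem_filter, mem_sumSupport] at h h'
    obtain ⟨a, rfl⟩ := ZMod.intCast_surjective a
    obtain ⟨b, rfl⟩ := ZMod.intCast_surjective b
    -- The record low of the translate of s by a lies at -a; since it is unique modulo n + 1, the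
    -- translate determines a, and hence s.
    have hs : IsRecordLow (fun z => s (z + (a : ZMod (n + 1)))) (-a) := by
      rw [isRecordLow_comp_add, neg_add_cancel]
      exact h.1.2
    have ht : IsRecordLow (fun z => t (z + (b : ZMod (n + 1)))) (-b) := by
      rw [isRecordLow_comp_add, neg_add_cancel]
      exact h'.1.2
    change (fun z => s (z + (a : ZMod (n + 1)))) = fun z => t (z + (b : ZMod (n + 1))) at heq
    rw [heq] at hs
    have hab := hs.eq_of_sum (by
      have := Equiv.sum_comp (Equiv.addRight (b : ZMod (n + 1))) t
      simp only [Equiv.coe_addRight] at this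
      rw [this, h'.1.1.1]) ht
    push_cast at hab
    have hab' : (a : ZMod (n + 1)) = b := neg_injective hab
    refine Prod.ext ?_ hab'
    funext z
    have := congrFun heq (z - a)
    rwa [← hab', sub_add_cancel] at this
  · intro s hs
    obtain ⟨x, hx⟩ := exists_isRecordLow (s := s) (by rw [(mem_sumSupport.1 hs).1]; omega)
    refine ⟨⟨fun z => s (z + (x : ZMod (n + 1))), -(x : ZMod (n + 1))⟩, ?_, ?_⟩
    · simp only [Finset.mem_product, Finset.mem_filter, Finset.mem_univ, and_true]
      refine ⟨hmem s x hs, ?_⟩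
      rw [isRecordLow_comp_add, zero_add]
      exact hx
    · funext z
      simp

end Counting

/-! ### Set partitions as equivalence relations -/

section Setoids

variable {n : ℕ}

/-- The relation of being in the same block. -/
def blockSetoid (π : Finpartition (Finset.univ : Finset (Fin n))) : Setoid (Fin n) :=
  Setoid.ker π.part

theorem blockSetoid_iff_mem {π : Finpartition (Finset.univ : Finset (Fin n))} {x y : Fin n} :
    blockSetoid π x y ↔ x ∈ π.part y := by
  rw [π.mem_part_iff_part_eq_part (Finset.mem_univ _) (Finset.mem_univ _)]
  rfl

theorem blockSetoid_iff_exists {π : Finpartition (Finset.univ : Finset (Fin n))} {x y : Fin n} :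
    blockSetoid π x y ↔ ∃ B ∈ π.parts, x ∈ B ∧ y ∈ B := by
  rw [blockSetoid_iff_mem, π.mem_part_iff_exists]

theorem blockSetoid_iff_mem_of_mem {π : Finpartition (Finset.univ : Finset (Fin n))} {x y : Fin n}
    {B : Finset (Fin n)} (hB : B ∈ π.parts) (hx : x ∈ B) : blockSetoid π x y ↔ y ∈ B := by
  rw [blockSetoid_iff_exists]
  constructor
  · rintro ⟨B', hB', hx', hy⟩
    rwa [π.eq_of_mem_parts hB hB' hx hx']
  · exact fun hy => ⟨B, hB, hx, hy⟩

open Classical in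
/-- Set partitions of `Fin n` correspond to equivalence relations. -/
noncomputable def blockSetoidEquiv (n : ℕ) :
    Finpartition (Finset.univ : Finset (Fin n)) ≃ Setoid (Fin n) where
  toFun := blockSetoid
  invFun S := Finpartition.ofSetoid S
  left_inv π := by
    have key : ∀ (π π' : Finpartition (Finset.univ : Finset (Fin n))),
        blockSetoid π = blockSetoid π' → π.parts ⊆ π'.parts := by
      intro π π' h B hB
      obtain ⟨x, hx⟩ := π.nonempty_of_mem_parts hB
      obtain ⟨B', hB', hx'⟩ := π'.exists_mem (Finset.mem_univ x)
      have : B = B' := by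
        ext y
        rw [← blockSetoid_iff_mem_of_mem hB hx, ← blockSetoid_iff_mem_of_mem hB' hx', h]
      rwa [this]
    have h : blockSetoid (Finpartition.ofSetoid (blockSetoid π)) = blockSetoid π := by
      ext x y
      rw [blockSetoid_iff_mem, Finpartition.mem_part_ofSetoid_iff_rel]
      exact Setoid.comm' _
    exact Finpartition.ext (Finset.Subset.antisymm (key _ _ h) (key _ _ h.symm))
  right_inv S := by
    ext x y
    rw [blockSetoid_iff_mem, Finpartition.mem_part_ofSetoid_iff_rel]
    exact Setoid.comm' S

theorem blockSetoid_injective : Function.Injective (blockSetoid (n := n)) :=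
  (blockSetoidEquiv n).injective

theorem isNoncrossing_iff {π : Finpartition (Finset.univ : Finset (Fin n))} :
    IsNoncrossing π ↔ ∀ a b c d : Fin n, a < b → b < c → c < d → blockSetoid π a c →
      blockSetoid π b d → blockSetoid π a b := by
  constructor
  · intro h a b c d hab hbc hcd hac hbd
    obtain ⟨B, hB, ha, hc⟩ := blockSetoid_iff_exists.1 hac
    obtain ⟨B', hB', hb, hd⟩ := blockSetoid_iff_exists.1 hbd
    have := h a b c d hab hbc hcd B hB B' hB' ha hc hb hd
    exact blockSetoid_iff_exists.2 ⟨B, hB, ha, this ▸ hb⟩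
  · intro h a b c d hab hbc hcd B hB B' hB' ha hc hb hd
    have := h a b c d hab hbc hcd (blockSetoid_iff_exists.2 ⟨B, hB, ha, hc⟩)
      (blockSetoid_iff_exists.2 ⟨B', hB', hb, hd⟩)
    exact π.eq_of_mem_parts hB hB' ((blockSetoid_iff_mem_of_mem hB ha).1 this) hb

theorem blockSetoid_permutePartition (σ : Equiv.Perm (Fin n))
    (π : Finpartition (Finset.univ : Finset (Fin n))) (x y : Fin n) :
    blockSetoid (permutePartition σ π) (σ x) (σ y) ↔ blockSetoid π x y := by
  simp [blockSetoid_iff_exists, permutePartition_parts]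

theorem permutePartition_eq_self_iff (σ : Equiv.Perm (Fin n))
    (π : Finpartition (Finset.univ : Finset (Fin n))) :
    permutePartition σ π = π ↔ ∀ x y, blockSetoid π (σ x) (σ y) ↔ blockSetoid π x y := by
  constructor
  · intro h x y
    conv_lhs => rw [← h]
    exact blockSetoid_permutePartition σ π x y
  · intro h
    apply blockSetoid_injective
    ext x y
    obtain ⟨x, rfl⟩ := σ.surjective x
    obtain ⟨y, rfl⟩ := σ.surjective y
    rw [blockSetoid_permutePartition, h]

/-- The number of blocks is the size of any transversal. -/
theorem card_parts_eq_of_transversal {π : Finpartition (Finset.univ : Finset (Fin n))}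
    (T : Finset (Fin n)) (hex : ∀ x, ∃ t ∈ T, blockSetoid π x t)
    (huniq : ∀ t ∈ T, ∀ t' ∈ T, blockSetoid π t t' → t = t') : π.parts.card = T.card := by
  symm
  refine Finset.card_bij (fun t _ => π.part t) (fun t _ => ?_) (fun t ht t' ht' h => ?_) ?_
  · exact π.part_mem.2 (Finset.mem_univ t)
  · exact huniq t ht t' ht' h
  · intro B hB
    obtain ⟨x, hx⟩ := π.nonempty_of_mem_parts hB
    obtain ⟨t, ht, hxt⟩ := hex x
    exact ⟨t, ht, π.part_eq_of_mem hB ((blockSetoid_iff_mem_of_mem hB hx).1 hxt)⟩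

end Setoids

/-! ### Noncrossing partitions as periodic relations with one central class of multiples -/

section Linear

variable {n : ℕ}

/-- The periodic relation on `ℤ` that repeats a relation on `{1, …, n}` with period `n + 1`, the
multiples of `n + 1` forming one further class. -/
def linearExtension (S : Setoid (Fin n)) : Setoid ℤ where
  r x y := (x % (n + 1 : ℕ) = 0 ∧ y % (n + 1 : ℕ) = 0) ∨ (x / (n + 1 : ℕ) = y / (n + 1 : ℕ) ∧
    ∃ i j : Fin n, x % (n + 1 : ℕ) = i + 1 ∧ y % (n + 1 : ℕ) = j + 1 ∧ S i j)
  iseqv := by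
    refine ⟨fun x => ?_, ?_, ?_⟩
    · have h1 := Int.emod_nonneg x (b := ((n + 1 : ℕ) : ℤ)) (by omega)
      have h2 := Int.emod_lt_of_pos x (b := ((n + 1 : ℕ) : ℤ)) (by omega)
      by_cases h0 : x % (n + 1 : ℕ) = 0
      · exact Or.inl ⟨h0, h0⟩
      · have h3 : x % (n + 1 : ℕ) = ((⟨(x % (n + 1 : ℕ)).toNat - 1, by omega⟩ : Fin n) : ℤ) + 1 := by
          simp only
          omega
        exact Or.inr ⟨rfl, _, _, h3, h3, S.refl _⟩
    · rintro x y (⟨h1, h2⟩ | ⟨h, i, j, h1, h2, h3⟩)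
      · exact Or.inl ⟨h2, h1⟩
      · exact Or.inr ⟨h.symm, j, i, h2, h1, S.symm h3⟩
    · rintro x y z (⟨h1, h2⟩ | ⟨h, i, j, h1, h2, h3⟩) (⟨h1', h2'⟩ | ⟨h', i', j', h1', h2', h3'⟩)
      · exact Or.inl ⟨h1, h2'⟩
      · omega
      · omega
      · have : j = i' := Fin.ext (by omega)
        exact Or.inr ⟨h.trans h', i, j', h1, h2', S.trans h3 (this ▸ h3')⟩

theorem linearExtension_iff {S : Setoid (Fin n)} {x y : ℤ} : linearExtension S x y ↔
    (x % (n + 1 : ℕ) = 0 ∧ y % (n + 1 : ℕ) = 0) ∨ (x / (n + 1 : ℕ) = y / (n + 1 : ℕ) ∧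
    ∃ i j : Fin n, x % (n + 1 : ℕ) = i + 1 ∧ y % (n + 1 : ℕ) = j + 1 ∧ S i j) := Iff.rfl

theorem ediv_eq_of_between {r a b c : ℤ} (hr : 0 < r) (hab : a ≤ b) (hbc : b ≤ c)
    (h : a / r = c / r) : b / r = a / r :=
  le_antisymm (h ▸ Int.ediv_le_ediv hr hbc) (Int.ediv_le_ediv hr hab)

/-- Every other class stays between two consecutive multiples of n + 1, so the class of multiples
crosses nothing. -/
theorem isPeriodicNoncrossing_linearExtension {S : Setoid (Fin n)}
    (hS : ∀ a b c d : Fin n, a < b → b < c → c < d → S a c → S b d → S a b) :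
    IsPeriodicNoncrossing (n + 1) (linearExtension S) := by
  have hr : (0 : ℤ) < (n + 1 : ℕ) := by omega
  refine ⟨⟨fun x y => ?_⟩, fun a b c d hab hbc hcd hac hbd => ?_, fun x y hxy hle => ?_⟩
  · rw [linearExtension_iff, linearExtension_iff, Int.add_emod_right, Int.add_emod_right,
      Int.add_ediv_of_dvd_right dvd_rfl, Int.add_ediv_of_dvd_right dvd_rfl,
      Int.ediv_self hr.ne', add_left_inj]
  · have ea := Int.emod_add_mul_ediv a (n + 1 : ℕ)
    have eb := Int.emod_add_mul_ediv b (n + 1 : ℕ)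
    have ec := Int.emod_add_mul_ediv c (n + 1 : ℕ)
    have ed := Int.emod_add_mul_ediv d (n + 1 : ℕ)
    rw [linearExtension_iff] at hac hbd ⊢
    rcases hac with ⟨h1, h2⟩ | ⟨h, i, k, h1, h2, h3⟩
    · rcases hbd with ⟨h1', h2'⟩ | ⟨h', j, l, h1', h2', h3'⟩
      · exact Or.inl ⟨h1, h1'⟩
      · have h4 := ediv_eq_of_between hr hbc.le hcd.le h'
        rw [h4] at ec
        omega
    · have h5 := ediv_eq_of_between hr hab.le hbc.le h
      rcases hbd with ⟨h1', h2'⟩ | ⟨h', j, l, h1', h2', h3'⟩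
      · rw [h5] at eb
        omega
      · refine Or.inr ⟨h5.symm, i, j, h1, h1', hS i j k l ?_ ?_ ?_ h3 h3'⟩
        · rw [h5] at eb
          rw [Fin.lt_def]
          omega
        · rw [h5, h] at eb
          rw [Fin.lt_def]
          omega
        · rw [← h', h5, h] at ed
          rw [Fin.lt_def]
          omega
  · rw [linearExtension_iff, Int.add_emod_right]
    rcases linearExtension_iff.1 hxy with ⟨h1, h2⟩ | ⟨h, _⟩
    · exact Or.inl ⟨h1, h1⟩
    · have := Int.ediv_le_ediv hr hle
      rw [Int.add_ediv_of_dvd_right dvd_rfl, Int.ediv_self hr.ne'] at this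
      omega

theorem linearExtension_central_iff {S : Setoid (Fin n)} {x : ℤ} :
    linearExtension S x (x + (n + 1 : ℕ)) ↔ x % (n + 1 : ℕ) = 0 := by
  have hr : (0 : ℤ) < (n + 1 : ℕ) := by omega
  rw [linearExtension_iff, Int.add_emod_right]
  constructor
  · rintro (⟨h, -⟩ | ⟨h, -⟩)
    · exact h
    · rw [Int.add_ediv_of_dvd_right dvd_rfl, Int.ediv_self hr.ne'] at h
      omega
  · exact fun h => Or.inl ⟨h, h⟩

/-- The restriction of a relation on `ℤ` to `{1, …, n}`. -/
def linearRestriction (n : ℕ) (R : Setoid ℤ) : Setoid (Fin n) :=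
  R.comap fun i => (i : ℤ) + 1

theorem linearRestriction_iff {R : Setoid ℤ} {i j : Fin n} :
    linearRestriction n R i j ↔ R ((i : ℤ) + 1) ((j : ℤ) + 1) := Iff.rfl

theorem linearRestriction_linearExtension (S : Setoid (Fin n)) :
    linearRestriction n (linearExtension S) = S := by
  ext i j
  have hi : ((i : ℤ) + 1) % (n + 1 : ℕ) = i + 1 := Int.emod_eq_of_lt (by omega) (by omega)
  have hj : ((j : ℤ) + 1) % (n + 1 : ℕ) = j + 1 := Int.emod_eq_of_lt (by omega) (by omega)
  have hi' : ((i : ℤ) + 1) / (n + 1 : ℕ) = 0 := Int.ediv_eq_zero_of_lt (by omega) (by omega)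
  have hj' : ((j : ℤ) + 1) / (n + 1 : ℕ) = 0 := Int.ediv_eq_zero_of_lt (by omega) (by omega)
  rw [linearRestriction_iff, linearExtension_iff, hi, hj, hi', hj']
  constructor
  · rintro (⟨h, -⟩ | ⟨-, i', j', h1, h2, h3⟩)
    · omega
    · obtain rfl : i = i' := Fin.ext (by omega)
      obtain rfl : j = j' := Fin.ext (by omega)
      exact h3
  · exact fun h => Or.inr ⟨rfl, i, j, rfl, rfl, h⟩

/-- Related elements in different windows would straddle a multiple of n + 1, which is related to
the next multiple beyond; noncrossing would then make x central. -/
theorem IsPeriodicNoncrossing.ediv_eq_of_rel {R : Setoid ℤ}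
    (hR : IsPeriodicNoncrossing (n + 1) R)
    (hc : ∀ x : ℤ, R x (x + (n + 1 : ℕ)) ↔ x % (n + 1 : ℕ) = 0) {x y : ℤ} (hxy : R x y)
    (hx : x % (n + 1 : ℕ) ≠ 0) : x / (n + 1 : ℕ) = y / (n + 1 : ℕ) := by
  have hr : (0 : ℤ) < (n + 1 : ℕ) := by omega
  have key : ∀ x y : ℤ, R x y → x % (n + 1 : ℕ) ≠ 0 →
      ¬ x / (n + 1 : ℕ) < y / (n + 1 : ℕ) := by
    intro x y hxy hx hlt
    have hy : y % (n + 1 : ℕ) ≠ 0 := by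
      rw [Ne, ← hc] at hx ⊢
      exact fun h => hx (hR.central_of_rel (R.symm hxy) h)
    have ex := Int.emod_add_mul_ediv x (n + 1 : ℕ)
    have ey := Int.emod_add_mul_ediv y (n + 1 : ℕ)
    have hx1 := Int.emod_lt_of_pos x hr
    have hy0 := Int.emod_nonneg y hr.ne'
    have hy1 := Int.emod_lt_of_pos y hr
    have hcc : R (((n + 1 : ℕ) : ℤ) * (y / (n + 1 : ℕ)))
        (((n + 1 : ℕ) : ℤ) * (y / (n + 1 : ℕ)) + (n + 1 : ℕ)) := by
      rw [hc]
      simp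
    have hmul : ((n + 1 : ℕ) : ℤ) * (x / (n + 1 : ℕ) + 1) ≤
        ((n + 1 : ℕ) : ℤ) * (y / (n + 1 : ℕ)) :=
      mul_le_mul_of_nonneg_left (by omega) hr.le
    rw [mul_add, mul_one] at hmul
    have := hR.noncrossing x _ y _ (by omega) (by omega) (by omega) hxy hcc
    rw [Ne, ← hc] at hx
    exact hx (hR.central_of_rel (R.symm this) hcc)
  have hy : y % (n + 1 : ℕ) ≠ 0 := by
    rw [Ne, ← hc] at hx ⊢
    exact fun h => hx (hR.central_of_rel (R.symm hxy) h)
  exact le_antisymm (not_lt.1 (key y x (R.symm hxy) hy)) (not_lt.1 (key x y hxy hx))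

theorem IsPeriodicNoncrossing.linearExtension_linearRestriction {R : Setoid ℤ}
    (hR : IsPeriodicNoncrossing (n + 1) R)
    (hc : ∀ x : ℤ, R x (x + (n + 1 : ℕ)) ↔ x % (n + 1 : ℕ) = 0) :
    linearExtension (linearRestriction n R) = R := by
  have hr : (0 : ℤ) < (n + 1 : ℕ) := by omega
  ext x y
  have ex := Int.emod_add_mul_ediv x (n + 1 : ℕ)
  have ey := Int.emod_add_mul_ediv y (n + 1 : ℕ)
  have hx0 := Int.emod_nonneg x hr.ne'
  have hx1 := Int.emod_lt_of_pos x hr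
  have hy0 := Int.emod_nonneg y hr.ne'
  have hy1 := Int.emod_lt_of_pos y hr
  rw [linearExtension_iff]
  constructor
  · rintro (⟨h1, h2⟩ | ⟨h, i, j, h1, h2, h3⟩)
    · exact hR.rel_of_central (by omega) ((hc x).2 h1) ((hc y).2 h2)
    · rw [linearRestriction_iff, ← h1, ← h2] at h3
      rw [← ex, ← ey, ← h, hR.add_mul_iff]
      exact h3
  · intro hxy
    by_cases hx : x % (n + 1 : ℕ) = 0
    · exact Or.inl ⟨hx, (hc y).1 (hR.central_of_rel hxy ((hc x).2 hx))⟩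
    · have hdiv := hR.ediv_eq_of_rel hc hxy hx
      have hy : y % (n + 1 : ℕ) ≠ 0 := fun h =>
        hx ((hc x).1 (hR.central_of_rel (R.symm hxy) ((hc y).2 h)))
      have hx3 : x % (n + 1 : ℕ) =
          ((⟨(x % (n + 1 : ℕ)).toNat - 1, by omega⟩ : Fin n) : ℤ) + 1 := by
        simp only
        omega
      have hy3 : y % (n + 1 : ℕ) =
          ((⟨(y % (n + 1 : ℕ)).toNat - 1, by omega⟩ : Fin n) : ℤ) + 1 := by
        simp only
        omega
      refine Or.inr ⟨hdiv, _, _, hx3, hy3, ?_⟩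
      rw [linearRestriction_iff, ← hx3, ← hy3, ← hR.add_mul_iff (x / (n + 1 : ℕ)), ex, hdiv, ey]
      exact hxy

/-- The number of blocks of a partition is the number of nonzero class sizes of its periodic
extension. -/
theorem card_parts_eq_card_support_linearExtension
    {π : Finpartition (Finset.univ : Finset (Fin n))} (hπ : IsNoncrossing π) :
    π.parts.card = ({z : ZMod (n + 1) | periodSizes (linearExtension (blockSetoid π)) z ≠ 0} :
      Finset (ZMod (n + 1))).card := by
  classical
  have hr : (0 : ℤ) < (n + 1 : ℕ) := by omega
  set R := linearExtension (blockSetoid π) with hRdef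
  have hR : IsPeriodicNoncrossing (n + 1) R :=
    isPeriodicNoncrossing_linearExtension (isNoncrossing_iff.1 hπ)
  have hc : ∀ x : ℤ, R x (x + (n + 1 : ℕ)) ↔ x % (n + 1 : ℕ) = 0 :=
    fun x => linearExtension_central_iff
  have hS : ∀ i j : Fin n, blockSetoid π i j ↔ R ((i : ℤ) + 1) ((j : ℤ) + 1) := by
    intro i j
    rw [← linearRestriction_iff, hRdef, linearRestriction_linearExtension]
  have hmod : ∀ i : Fin n, ((i : ℤ) + 1) % (n + 1 : ℕ) = i + 1 := fun i =>
    Int.emod_eq_of_lt (by omega) (by omega)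
  rw [card_parts_eq_of_transversal {i : Fin n | IsClassMin R (n + 1) ((i : ℤ) + 1)},
    hR.card_support_periodSizes 0]
  · refine Finset.card_bij (fun i _ => (i : ℤ) + 1) ?_ ?_ ?_
    · intro i hi
      simp only [Finset.mem_filter, Finset.mem_univ, true_and, Finset.mem_Ico] at hi ⊢
      exact ⟨by omega, hi⟩
    · intro i _ j _ hij
      exact Fin.ext (by omega)
    · intro u hu
      simp only [Finset.mem_filter, Finset.mem_Ico] at hu
      have hu0 : u ≠ 0 := by
        rintro rfl
        exact hu.2.1 ((hc 0).2 (by simp))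
      refine ⟨⟨u.toNat - 1, by omega⟩, ?_, ?_⟩
      · simp only [Finset.mem_filter, Finset.mem_univ, true_and]
        convert hu.2
        omega
      · simp only
        omega
  · intro i
    have hi : ¬ R ((i : ℤ) + 1) ((i : ℤ) + 1 + (n + 1 : ℕ)) := by
      rw [hc, hmod]
      omega
    obtain ⟨p, hpi, hRp, hp⟩ := hR.exists_isClassMin hi
    have hp0 : p % (n + 1 : ℕ) ≠ 0 := fun h => hp.1 ((hc p).2 h)
    have h1 := hR.ediv_eq_of_rel hc hRp hp0
    have h2 : ((i : ℤ) + 1) / (n + 1 : ℕ) = 0 := Int.ediv_eq_zero_of_lt (by omega) (by omega)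
    have h3 := Int.emod_add_mul_ediv p (n + 1 : ℕ)
    have h4 := Int.emod_nonneg p hr.ne'
    rw [h1, h2, mul_zero] at h3
    have hp' : (((⟨p.toNat - 1, by omega⟩ : Fin n) : ℕ) : ℤ) + 1 = p := by
      simp only
      omega
    refine ⟨⟨p.toNat - 1, by omega⟩, ?_, ?_⟩
    · simp only [Finset.mem_filter, Finset.mem_univ, true_and]
      rw [hp']
      exact hp
    · rw [hS, hp']
      exact R.symm hRp
  · intro t ht t' ht' h
    simp only [Finset.mem_filter, Finset.mem_univ, true_and] at ht ht'
    rw [hS] at h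
    have := IsPeriodicNoncrossing.isClassMin_unique ht ht' h (R.refl _)
    exact Fin.ext (by omega)

/-- Noncrossing partitions correspond to functions on `ℤ/(n + 1)ℤ` with sum `n` and a record low
at `0`. -/
theorem card_noncrossingPartition (n k : ℕ) [DecidablePred fun s : ZMod (n + 1) → ℕ =>
    IsRecordLow s 0] : Nat.card (NoncrossingPartition n k) =
    ({s ∈ sumSupport (ZMod (n + 1)) n k | IsRecordLow s 0} :
      Finset (ZMod (n + 1) → ℕ)).card := by
  have hext : ∀ π : NoncrossingPartition n k,
      IsPeriodicNoncrossing (n + 1) (linearExtension (blockSetoid π.1)) := fun π =>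
    isPeriodicNoncrossing_linearExtension (isNoncrossing_iff.1 π.2.1)
  rw [← Nat.card_eq_finsetCard]
  refine Nat.card_congr (Equiv.ofBijective (fun π => ⟨periodSizes
    (linearExtension (blockSetoid π.1)), ?_⟩) ⟨?_, ?_⟩)
  · have hR := hext π
    have h0 : IsRecordLow (periodSizes (r := n + 1) (linearExtension (blockSetoid π.1))) 0 := by
      rw [← hR.central_iff, linearExtension_central_iff]
      simp
    rw [Finset.mem_filter, mem_sumSupport]
    refine ⟨⟨?_, ?_⟩, h0⟩
    -- The central elements are exactly the multiples of n + 1, so the record lows form one residue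
    -- class and the sum is n.
    · have := h0.sum_eq fun y hy => by
        rw [← hR.central_iff, linearExtension_central_iff] at hy
        rw [ZMod.intCast_eq_intCast_iff_dvd_sub, sub_zero]
        exact Int.dvd_of_emod_eq_zero hy
      omega
    · rw [← card_parts_eq_card_support_linearExtension π.2.1, π.2.2]
  · intro π π' h
    have h1 : periodSizes (r := n + 1) (linearExtension (blockSetoid π.1)) =
        periodSizes (linearExtension (blockSetoid π'.1)) := congrArg Subtype.val h
    have h2 := congrArg Subtype.val ((periodicNoncrossingEquiv (n + 1)).injective
      (a₁ := ⟨_, hext π⟩) (a₂ := ⟨_, hext π'⟩) (Subtype.ext h1))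
    have h3 : linearExtension (blockSetoid π.1) = linearExtension (blockSetoid π'.1) := h2
    refine Subtype.ext (blockSetoid_injective ?_)
    rw [← linearRestriction_linearExtension (blockSetoid π.1), h3,
      linearRestriction_linearExtension]
  · rintro ⟨s, hs⟩
    rw [Finset.mem_filter, mem_sumSupport] at hs
    obtain ⟨⟨hsum, hsupp⟩, h0⟩ := hs
    obtain ⟨⟨R, hR⟩, hRs⟩ := (periodicNoncrossingEquiv (n + 1)).surjective ⟨s, by omega⟩
    obtain rfl : periodSizes R = s := congrArg Subtype.val hRs
    have hc : ∀ x : ℤ, R x (x + (n + 1 : ℕ)) ↔ x % (n + 1 : ℕ) = 0 := by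
      intro x
      rw [hR.central_iff]
      constructor
      · intro hx
        have := h0.eq_of_sum (by omega) hx
        rw [ZMod.intCast_eq_intCast_iff_dvd_sub, sub_zero] at this
        exact Int.emod_eq_zero_of_dvd this
      · intro hx
        rw [← isRecordLow_emod, hx]
        exact h0
    obtain ⟨π, hπ⟩ := (blockSetoidEquiv n).surjective (linearRestriction n R)
    replace hπ : blockSetoid π = linearRestriction n R := hπ
    have hext' : linearExtension (blockSetoid π) = R := by
      rw [hπ, hR.linearExtension_linearRestriction hc]
    have hnc : IsNoncrossing π := isNoncrossing_iff.2 fun a b c d hab hbc hcd => by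
      rw [hπ]
      simp only [linearRestriction_iff, Fin.lt_def] at *
      exact hR.noncrossing _ _ _ _ (by omega) (by omega) (by omega)
    refine ⟨⟨π, hnc, ?_⟩, Subtype.ext ?_⟩
    · rw [card_parts_eq_card_support_linearExtension hnc, hext', hsupp]
    · change periodSizes (linearExtension (blockSetoid π)) = _
      rw [hext']

end Linear

/-! ### Noncrossing relations on a cycle that are invariant under a proper rotation -/

/-- An equivalence relation on the cycle `ℤ/nℤ`, pulled back to `ℤ`, that is noncrossing and
invariant under translation by `r`. -/
structure IsCyclicNoncrossing (n r : ℕ) (Q : Setoid ℤ) : Prop extends IsShiftInvariant r Q where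
  rel_add : ∀ x : ℤ, Q x (x + n)
  noncrossing : ∀ a b c d : ℤ, a < b → b < c → c < d → d < a + n → Q a c → Q b d → Q a b

namespace IsCyclicNoncrossing

variable {n r m : ℕ} {Q : Setoid ℤ}

theorem isShiftInvariant (hQ : IsCyclicNoncrossing n r Q) : IsShiftInvariant n Q :=
  ⟨fun x y => ⟨fun h => Q.trans (hQ.rel_add x) (Q.trans h (Q.symm (hQ.rel_add y))),
    fun h => Q.trans (Q.symm (hQ.rel_add x)) (Q.trans h (hQ.rel_add y))⟩⟩

theorem rel_add_cycle_mul (hQ : IsCyclicNoncrossing n r Q) (x a : ℤ) : Q x (x + n * a) :=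
  hQ.isShiftInvariant.rel_add_mul (hQ.rel_add x) a

theorem rel_add_cycle_mul_iff (hQ : IsCyclicNoncrossing n r Q) (x y a : ℤ) :
    Q x (y + n * a) ↔ Q x y :=
  ⟨fun h => Q.trans h (Q.symm (hQ.rel_add_cycle_mul y a)),
    fun h => Q.trans h (hQ.rel_add_cycle_mul y a)⟩

/-- Otherwise the pair x, z crosses the translate x + r, y + r. This yields transitivity of
`unroll`. -/
theorem lt_add_of_lt_add (hQ : IsCyclicNoncrossing n r Q) (hrn : 2 * r ≤ n) (hr : 0 < r)
    {x y z : ℤ} (hxy : Q x y) (hxz : Q x z) (hx : ¬ Q x (x + r)) (h1 : y < x + r)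
    (h2 : z < y + r) : z < x + r := by
  by_contra hle
  rcases (not_lt.1 hle).eq_or_lt with rfl | hlt
  · exact hx hxz
  · exact hx (hQ.noncrossing x (x + r) z (y + r) (by omega) hlt h2 (by omega) hxz
      ((hQ.add_iff x y).2 hxy))

/-- A block moved by the rotation cannot meet the middle of the window: the pair x, y would cross
its translate by r. -/
theorem span (hQ : IsCyclicNoncrossing n r Q) (hr : 0 < r) {x y : ℤ} (hxy : Q x y)
    (hx : ¬ Q x (x + r)) (h2 : y < x + n) : y < x + r ∨ x + n - r < y := by
  by_contra! h
  rcases h.1.eq_or_lt with rfl | h3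
  · exact hx hxy
  rcases h.2.eq_or_lt with rfl | h4
  · have h5 := (hQ.add_iff _ _).2 hxy
    rw [sub_add_cancel] at h5
    exact hx (Q.symm (Q.trans h5 (Q.symm (hQ.rel_add x))))
  · exact hx (hQ.noncrossing x (x + r) y (y + r) (by omega) h3 (by omega) (by omega) hxy
      ((hQ.add_iff x y).2 hxy))

/-- The relation on `ℤ` obtained by unrolling the classes that are not invariant under
translation by `r`. -/
def unroll (hQ : IsCyclicNoncrossing n r Q) (hrn : 2 * r ≤ n) (hr : 0 < r) : Setoid ℤ where
  r x y := Q x y ∧ ((x < y + r ∧ y < x + r) ∨ Q x (x + r))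
  iseqv := by
    refine ⟨fun x => ⟨Q.refl x, Or.inl (by omega)⟩, ?_, ?_⟩
    · rintro x y ⟨h1, h2 | h2⟩
      · exact ⟨Q.symm h1, Or.inl ⟨h2.2, h2.1⟩⟩
      · exact ⟨Q.symm h1, Or.inr (hQ.central_of_rel h1 h2)⟩
    · rintro x y z ⟨h1, h2⟩ ⟨h3, h4⟩
      refine ⟨Q.trans h1 h3, ?_⟩
      by_cases hx : Q x (x + r)
      · exact Or.inr hx
      have hy : ¬ Q y (y + r) := fun h => hx (hQ.central_of_rel (Q.symm h1) h)
      have hz : ¬ Q z (z + r) := fun h => hy (hQ.central_of_rel (Q.symm h3) h)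
      replace h2 := h2.resolve_right hx
      replace h4 := h4.resolve_right hy
      exact Or.inl ⟨hQ.lt_add_of_lt_add hrn hr (Q.symm h3) (Q.symm (Q.trans h1 h3)) hz h4.1 h2.1,
        hQ.lt_add_of_lt_add hrn hr h1 (Q.trans h1 h3) hx h2.2 h4.2⟩

theorem unroll_iff (hQ : IsCyclicNoncrossing n r Q) (hrn : 2 * r ≤ n) (hr : 0 < r) {x y : ℤ} :
    hQ.unroll hrn hr x y ↔ Q x y ∧ ((x < y + r ∧ y < x + r) ∨ Q x (x + r)) := Iff.rfl

theorem unroll_central_iff (hQ : IsCyclicNoncrossing n r Q) (hrn : 2 * r ≤ n) (hr : 0 < r)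
    {x : ℤ} : hQ.unroll hrn hr x (x + r) ↔ Q x (x + r) := by
  rw [unroll_iff]
  exact ⟨fun h => h.1, fun h => ⟨h, Or.inr h⟩⟩

theorem isPeriodicNoncrossing_unroll (hQ : IsCyclicNoncrossing n r Q) (hrn : 2 * r ≤ n)
    (hr : 0 < r) : IsPeriodicNoncrossing r (hQ.unroll hrn hr) := by
  refine ⟨⟨fun x y => ?_⟩, fun a b c d hab hbc hcd hac hbd => ?_, fun x y hxy hle => ?_⟩
  · rw [unroll_iff, unroll_iff, hQ.add_iff, hQ.add_iff]
    refine and_congr_right fun _ => or_congr_left ?_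
    constructor <;> intro h <;> omega
  · rw [unroll_iff] at hac hbd ⊢
    by_cases ha : Q a (a + r)
    · refine ⟨?_, Or.inr ha⟩
      by_cases hb : Q b (b + r)
      · exact hQ.rel_of_central hr
          (fun a b c d h1 h2 h3 h4 => hQ.noncrossing a b c d h1 h2 h3 (by omega)) ha hb
      · have hb2 := hbd.2.resolve_right hb
        -- The pair c, c + r crosses b, d, because d < b + r.
        have hc := hQ.central_of_rel hac.1 ha
        have := hQ.noncrossing b c d (c + r) hbc hcd (by omega) (by omega) hbd.1 hc
        exact absurd (hQ.central_of_rel (Q.symm this) hc) hb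
    · have ha2 := hac.2.resolve_right ha
      by_cases hb : Q b (b + r)
      · have := hQ.noncrossing a b c (b + r) hab hbc (by omega) (by omega) hac.1 hb
        exact absurd (hQ.central_of_rel (Q.symm this) hb) ha
      · have hb2 := hbd.2.resolve_right hb
        exact ⟨hQ.noncrossing a b c d hab hbc hcd (by omega) hac.1 hbd.1, Or.inl (by omega)⟩
  · rw [unroll_iff] at hxy
    rw [unroll_central_iff]
    exact hxy.2.resolve_left (by omega)

end IsCyclicNoncrossing

/-! ### Rolling a periodic relation up onto the cycle -/

namespace IsPeriodicNoncrossing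

variable {n r m : ℕ} {R : Setoid ℤ}

theorem add_cycle_mul_iff (hR : IsPeriodicNoncrossing r R) (hn : n = r * m) (x y a : ℤ) :
    R (x + n * a) (y + n * a) ↔ R x y := by
  rw [hn]
  push_cast
  rw [mul_assoc, hR.add_mul_iff]

/-- The relation on the cycle of length `n` induced by an `r`-periodic relation, for `r ∣ n`. -/
def roll (hR : IsPeriodicNoncrossing r R) (hn : n = r * m) : Setoid ℤ where
  r x y := ∃ a : ℤ, R x (y + n * a)
  iseqv := by
    refine ⟨fun x => ⟨0, by simp⟩, ?_, ?_⟩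
    · rintro x y ⟨a, h⟩
      refine ⟨-a, R.symm ((hR.add_cycle_mul_iff hn _ _ a).1 ?_)⟩
      convert h using 1
      ring
    · rintro x y z ⟨a, h⟩ ⟨b, h'⟩
      refine ⟨b + a, R.trans h ?_⟩
      rw [mul_add, ← add_assoc]
      exact (hR.add_cycle_mul_iff hn _ _ a).2 h'

theorem roll_iff (hR : IsPeriodicNoncrossing r R) (hn : n = r * m) {x y : ℤ} :
    hR.roll hn x y ↔ ∃ a : ℤ, R x (y + n * a) := Iff.rfl

theorem rel_add_cycle_mul (hR : IsPeriodicNoncrossing r R) (hn : n = r * m) {x : ℤ}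
    (hx : R x (x + r)) (a : ℤ) : R x (x + n * a) := by
  rw [hn]
  push_cast
  rw [mul_assoc]
  exact hR.rel_add_mul hx _

theorem abs_lt_of_rel (hR : IsPeriodicNoncrossing r R) {x y : ℤ} (hx : ¬ R x (x + r))
    (h : R x y) : x < y + r ∧ y < x + r :=
  ⟨hR.lt_add_of_rel (R.symm h) fun h' => hx (hR.central_of_rel (R.symm h) h'),
    hR.lt_add_of_rel h hx⟩

theorem isCyclicNoncrossing_roll (hR : IsPeriodicNoncrossing r R) (hn : n = r * m) (hrn : r ≤ n) :
    IsCyclicNoncrossing n r (hR.roll hn) := by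
  refine ⟨⟨fun x y => ?_⟩, fun x => ⟨-1, by simp⟩, fun a b c d hab hbc hcd hda hac hbd => ?_⟩
  · rw [roll_iff, roll_iff]
    refine exists_congr fun a => ?_
    rw [← hR.add_iff x, add_right_comm]
  -- Only the lifts a = 0 and a = -1 matter for a class of spread less than r: y is joined to x
  -- directly, or to x + n around the cycle. The four combinations below are noncrossing statements
  -- in ℤ.
  · have key : ∀ x y : ℤ, x < y → y < x + n → hR.roll hn x y → R x y ∨ R y (x + n) := by
      rintro x y hxy hyx ⟨a, h⟩
      by_cases hx : R x (x + r)
      · have hy := hR.central_of_rel h hx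
        have h1 := hR.rel_add_cycle_mul hn hy (-a)
        refine Or.inl (R.trans h ?_)
        convert h1 using 1
        ring
      · have h1 := hR.abs_lt_of_rel hx h
        have ha0 : a < 1 := by
          by_contra ha
          have : (n : ℤ) * 1 ≤ n * a := mul_le_mul_of_nonneg_left (by omega) (by omega)
          omega
        have ha1 : -2 < a := by
          by_contra ha
          have : (n : ℤ) * a ≤ n * (-2) := mul_le_mul_of_nonneg_left (by omega) (by omega)
          omega
        obtain rfl | rfl : a = 0 ∨ a = -1 := by omega
        · left; simpa using h
        · right
          rw [← hR.add_cycle_mul_iff hn _ _ 1] at h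
          refine R.symm ?_
          convert h using 1 <;> ring
    rcases key a c (by omega) (by omega) hac with h1 | h1 <;>
      rcases key b d (by omega) (by omega) hbd with h2 | h2
    · exact ⟨0, by simpa using hR.noncrossing a b c d hab hbc hcd h1 h2⟩
    · have h3 : R (d + n * (-1)) b := by
        rw [← hR.add_cycle_mul_iff hn _ _ 1]
        convert h2 using 1 <;> ring
      have h4 := hR.noncrossing (d + n * (-1)) a b c (by omega) hab hbc h3 h1
      exact ⟨0, by simpa using R.trans (R.symm h4) h3⟩
    · have h3 := hR.noncrossing b c d (a + n) hbc hcd hda h2 h1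
      refine ⟨-1, R.symm ((hR.add_cycle_mul_iff hn _ _ 1).1 ?_)⟩
      convert R.trans h3 h1 using 1 <;> ring
    · have h3 := hR.noncrossing c d (a + n) (b + n) hcd hda (by omega) h1 h2
      have h4 : R (a + n * 1) (b + n * 1) := by
        simpa using R.trans (R.symm h1) (R.trans h3 h2)
      exact ⟨0, by simpa using (hR.add_cycle_mul_iff hn _ _ 1).1 h4⟩

/-- For a noncentral x the relation would give |r + n a| < r, that is 1 + m a = 0, against m ≥ 2. -/
theorem roll_central_iff (hR : IsPeriodicNoncrossing r R) (hn : n = r * m) (hm : 2 ≤ m)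
    {x : ℤ} : hR.roll hn x (x + r) ↔ R x (x + r) := by
  constructor
  · rintro ⟨a, h⟩
    by_contra hx
    have h1 := hR.abs_lt_of_rel hx h
    have h2 : (r : ℤ) + n * a = r * (1 + m * a) := by
      rw [hn]; push_cast; ring
    have h3 : (r : ℤ) * (1 + m * a) < r * 1 := by omega
    have h4 : (r : ℤ) * (-1) < r * (1 + m * a) := by omega
    have h5 := lt_of_mul_lt_mul_left h3 (by omega)
    have h6 := lt_of_mul_lt_mul_left h4 (by omega)
    have h7 : (m : ℤ) ∣ 1 := ⟨-a, by linarith⟩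
    have := Int.le_of_dvd one_pos h7
    omega
  · exact fun h => ⟨0, by simpa using h⟩

theorem unroll_roll (hR : IsPeriodicNoncrossing r R) (hn : n = r * m) (hm : 2 ≤ m)
    (hr : 0 < r) (hrn : 2 * r ≤ n) :
    (hR.isCyclicNoncrossing_roll hn (by omega)).unroll hrn hr = R := by
  ext x y
  rw [IsCyclicNoncrossing.unroll_iff, hR.roll_central_iff hn hm, roll_iff]
  constructor
  · rintro ⟨⟨a, h⟩, h2⟩
    by_cases hx : R x (x + r)
    · have hy := hR.central_of_rel h hx
      have h1 := hR.rel_add_cycle_mul hn hy (-a)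
      refine R.trans h ?_
      convert h1 using 1
      ring
    · have h1 := hR.abs_lt_of_rel hx h
      replace h2 := h2.resolve_right hx
      have ha0 : a < 1 := by
        by_contra ha
        have : (n : ℤ) * 1 ≤ n * a := mul_le_mul_of_nonneg_left (by omega) (by omega)
        omega
      have ha1 : -1 < a := by
        by_contra ha
        have : (n : ℤ) * a ≤ n * (-1) := mul_le_mul_of_nonneg_left (by omega) (by omega)
        omega
      obtain rfl : a = 0 := by omega
      simpa using h
  · intro h
    refine ⟨⟨0, by simpa using h⟩, ?_⟩
    by_cases hx : R x (x + r)
    · exact Or.inr hx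
    · exact Or.inl (hR.abs_lt_of_rel hx h)

end IsPeriodicNoncrossing

theorem IsCyclicNoncrossing.roll_unroll {n r m : ℕ} {Q : Setoid ℤ}
    (hQ : IsCyclicNoncrossing n r Q) (hn : n = r * m) (hr : 0 < r) (hrn : 2 * r ≤ n) :
    (hQ.isPeriodicNoncrossing_unroll hrn hr).roll hn = Q := by
  ext x y
  rw [IsPeriodicNoncrossing.roll_iff]
  simp only [unroll_iff, hQ.rel_add_cycle_mul_iff]
  constructor
  · rintro ⟨a, h, -⟩
    exact h
  · intro h
    by_cases hx : Q x (x + r)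
    · exact ⟨0, h, Or.inr hx⟩
    have hn0 : (0 : ℤ) < n := by omega
    have h1 := Int.emod_nonneg (y - x) hn0.ne'
    have h2 := Int.emod_lt_of_pos (y - x) hn0
    have h3 := Int.emod_add_mul_ediv (y - x) n
    set a := (y - x) / (n : ℤ)
    have h4 : y + n * (-a) = x + (y - x) % n := by rw [mul_neg]; omega
    -- By `span`, the lift of y to [x, x + n) is close to x, or close to x + n; in the latter case
    -- it is moved back by one turn.
    rcases hQ.span hr ((hQ.rel_add_cycle_mul_iff x y (-a)).2 h) hx (by omega) with h5 | h5
    · exact ⟨-a, h, Or.inl (by omega)⟩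
    · refine ⟨-a - 1, h, Or.inl ?_⟩
      rw [mul_sub, mul_one]
      omega

/-! ### Partitions of `Fin n` as n-periodic relations on ℤ -/

section Residues

variable {n : ℕ} [NeZero n]

/-- The residue of an integer modulo `n`, as an element of `Fin n`. -/
def intToFin (n : ℕ) [NeZero n] (x : ℤ) : Fin n :=
  ⟨(x % n).toNat, by
    have h0 : (0 : ℤ) < n := by exact_mod_cast NeZero.pos n
    have := Int.emod_lt_of_pos x h0
    have := Int.emod_nonneg x h0.ne'
    omega⟩

theorem intToFin_val (x : ℤ) : ((intToFin n x : ℕ) : ℤ) = x % n :=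
  Int.toNat_of_nonneg (Int.emod_nonneg x (by exact_mod_cast NeZero.ne n))

theorem intToFin_natCast (i : Fin n) : intToFin n ((i : ℕ) : ℤ) = i := by
  apply Fin.ext
  have := intToFin_val (n := n) ((i : ℕ) : ℤ)
  rw [Int.emod_eq_of_lt (by omega) (by omega)] at this
  exact_mod_cast this

theorem intToFin_add_mul (x a : ℤ) : intToFin n (x + n * a) = intToFin n x := by
  apply Fin.ext
  have h1 := intToFin_val (n := n) (x + n * a)
  rw [Int.add_mul_emod_self_left, ← intToFin_val] at h1
  exact_mod_cast h1

theorem eq_intToFin_add (x : ℤ) : x = ((intToFin n x : ℕ) : ℤ) + n * (x / n) := by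
  rw [intToFin_val, Int.emod_add_mul_ediv]

theorem cyclicRotation_intToFin (t : ℕ) (x : ℤ) :
    cyclicRotation n (Multiplicative.ofAdd (t : ZMod n)) (intToFin n x) = intToFin n (x + t) := by
  apply Fin.ext
  rw [cyclicRotation_val, toAdd_ofAdd, ZMod.val_natCast, Nat.add_mod_mod]
  have h : (((intToFin n x : ℕ) + t) % n : ℤ) = (intToFin n (x + t) : ℕ) := by
    rw [intToFin_val, intToFin_val, Int.emod_add_emod]
  exact_mod_cast h

theorem comap_intToFin_iff {S : Setoid (Fin n)} {x y : ℤ} :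
    S.comap (intToFin n) x y ↔ S (intToFin n x) (intToFin n y) := Iff.rfl

theorem permutePartition_cyclicRotation_eq_self_iff (t : ℕ)
    (π : Finpartition (Finset.univ : Finset (Fin n))) :
    permutePartition (cyclicRotation n (Multiplicative.ofAdd (t : ZMod n))) π = π ↔
      IsShiftInvariant t ((blockSetoid π).comap (intToFin n)) := by
  rw [permutePartition_eq_self_iff]
  constructor
  · refine fun h => ⟨fun x y => ?_⟩
    rw [comap_intToFin_iff, comap_intToFin_iff, ← cyclicRotation_intToFin, ← cyclicRotation_intToFin]
    exact h _ _
  · intro h x y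
    have := h.add_iff ((x : ℕ) : ℤ) ((y : ℕ) : ℤ)
    rwa [comap_intToFin_iff, comap_intToFin_iff, ← cyclicRotation_intToFin,
      ← cyclicRotation_intToFin, intToFin_natCast, intToFin_natCast] at this

theorem isCyclicNoncrossing_comap {r : ℕ} {S : Setoid (Fin n)}
    (hS : ∀ a b c d : Fin n, a < b → b < c → c < d → S a c → S b d → S a b)
    (hr : IsShiftInvariant r (S.comap (intToFin n))) :
    IsCyclicNoncrossing n r (S.comap (intToFin n)) := by
  have h0 : (0 : ℤ) < n := by exact_mod_cast NeZero.pos n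
  refine ⟨hr, fun x => ?_, fun a b c d hab hbc hcd hda hac hbd => ?_⟩
  · have := intToFin_add_mul (n := n) x 1
    rw [mul_one] at this
    rw [Setoid.comap_rel, this]
  · rw [Setoid.comap_rel] at *
    -- On a window of length n, reduction modulo n is a translation followed by at most one wrap, so
    -- the four residues appear in one of four cyclic orders.
    have key : ∀ x, a ≤ x → x < a + n → (((intToFin n x : ℕ) : ℤ) = x - n * (a / n) ∨
        ((intToFin n x : ℕ) : ℤ) = x - n * (a / n) - n) := by
      intro x h1 h2
      have h3 := Int.ediv_le_ediv h0 h1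
      have h4 := Int.ediv_le_ediv h0 h2.le
      rw [Int.add_ediv_of_dvd_right dvd_rfl, Int.ediv_self h0.ne'] at h4
      have h5 := eq_intToFin_add (n := n) x
      obtain h6 | h6 : x / (n : ℤ) = a / n ∨ x / (n : ℤ) = a / n + 1 := by omega
      · rw [h6] at h5; omega
      · rw [h6, mul_add, mul_one] at h5; omega
    have ha := key a le_rfl (by omega)
    have hb := key b (by omega) (by omega)
    have hc := key c (by omega) (by omega)
    have hd := key d (by omega) (by omega)
    have cases4 : (intToFin n a < intToFin n b ∧ intToFin n b < intToFin n c ∧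
          intToFin n c < intToFin n d) ∨
        (intToFin n b < intToFin n c ∧ intToFin n c < intToFin n d ∧
          intToFin n d < intToFin n a) ∨
        (intToFin n c < intToFin n d ∧ intToFin n d < intToFin n a ∧
          intToFin n a < intToFin n b) ∨
        (intToFin n d < intToFin n a ∧ intToFin n a < intToFin n b ∧
          intToFin n b < intToFin n c) := by
      simp only [Fin.lt_def]
      omega
    rcases cases4 with ⟨p, q, s⟩ | ⟨p, q, s⟩ | ⟨p, q, s⟩ | ⟨p, q, s⟩
    · exact hS _ _ _ _ p q s hac hbd
    · exact S.trans hac (S.symm (hS _ _ _ _ p q s hbd (S.symm hac)))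
    · exact S.trans hac (S.trans (hS _ _ _ _ p q s (S.symm hac) (S.symm hbd)) (S.symm hbd))
    · exact S.symm (S.trans hbd (hS _ _ _ _ p q s (S.symm hbd) hac))

theorem comap_comap_intToFin {r : ℕ} {Q : Setoid ℤ} (hQ : IsCyclicNoncrossing n r Q) :
    (Q.comap fun i : Fin n => ((i : ℕ) : ℤ)).comap (intToFin n) = Q := by
  ext x y
  rw [Setoid.comap_rel, Setoid.comap_rel]
  conv_rhs => rw [eq_intToFin_add (n := n) x, eq_intToFin_add (n := n) y]
  rw [hQ.rel_add_cycle_mul_iff]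
  exact ⟨fun h => Q.trans (Q.symm (hQ.rel_add_cycle_mul _ _)) h,
    fun h => Q.trans (hQ.rel_add_cycle_mul _ _) h⟩

theorem comap_intToFin_injective :
    Function.Injective fun S : Setoid (Fin n) => S.comap (intToFin n) := by
  intro S S' h
  ext i j
  have : S.comap (intToFin n) ((i : ℕ) : ℤ) ((j : ℕ) : ℤ) ↔
      S'.comap (intToFin n) ((i : ℕ) : ℤ) ((j : ℕ) : ℤ) := by
    simp only at h
    rw [h]
  simpa only [Setoid.comap_rel, intToFin_natCast] using this

end Residues

/-! ### Counting the partitions fixed by a proper rotation -/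

section Fixed

variable {n r m : ℕ} [NeZero n] [NeZero r]

theorem IsPeriodicNoncrossing.card_isClassMin_range {R : Setoid ℤ}
    (hR : IsPeriodicNoncrossing r R) (m : ℕ) [DecidablePred (IsClassMin R r)] :
    ({u ∈ Finset.Ico (0 : ℤ) (r * m) | IsClassMin R r u} : Finset ℤ).card =
      m * ({z : ZMod r | periodSizes R z ≠ 0} : Finset (ZMod r)).card := by
  induction m with
  | zero => simp
  | succ m ih =>
    have h : Finset.Ico (0 : ℤ) (r * (m + 1 : ℕ)) =
        Finset.Ico (0 : ℤ) (r * m) ∪ Finset.Ico ((r : ℤ) * m) (r * m + r) := by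
      rw [Finset.Ico_union_Ico_eq_Ico (by positivity) (by omega)]
      push_cast
      ring_nf
    rw [h, Finset.filter_union, Finset.card_union_of_disjoint, ih,
      ← hR.card_support_periodSizes (r * m)]
    · ring
    · exact Finset.disjoint_filter_filter (Finset.Ico_disjoint_Ico_consecutive _ _ _)

open Classical in
/-- The number of blocks of an invariant noncrossing partition, in terms of the unrolled
relation. -/
theorem card_parts_of_isCyclicNoncrossing {π : Finpartition (Finset.univ : Finset (Fin n))}
    (hQ : IsCyclicNoncrossing n r ((blockSetoid π).comap (intToFin n))) (hn : n = r * m)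
    (hr : 0 < r) (hrn : 2 * r ≤ n) :
    π.parts.card = m * ({z : ZMod r | periodSizes (hQ.unroll hrn hr) z ≠ 0} :
      Finset (ZMod r)).card + if ∃ x, hQ.unroll hrn hr x (x + r) then 1 else 0 := by
  have hR := hQ.isPeriodicNoncrossing_unroll hrn hr
  have hroll := hQ.roll_unroll hn hr hrn
  have hS : ∀ i j : Fin n, blockSetoid π i j ↔
      ∃ a : ℤ, hQ.unroll hrn hr ((i : ℕ) : ℤ) (((j : ℕ) : ℤ) + n * a) := by
    intro i j
    rw [← hR.roll_iff hn, hroll, comap_intToFin_iff, intToFin_natCast, intToFin_natCast]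
  set R := hQ.unroll hrn hr
  have hmin : ∀ (x a : ℤ), IsClassMin R r (x + n * a) ↔ IsClassMin R r x := by
    intro x a
    have := hR.isClassMin_add_mul_iff (m * a) x
    rwa [← mul_assoc, ← Nat.cast_mul, ← hn] at this
  have hcen : ∀ (x a : ℤ), R (x + n * a) (x + n * a + r) ↔ R x (x + r) := by
    intro x a
    have := hR.central_add_mul_iff (m * a) x
    rwa [← mul_assoc, ← Nat.cast_mul, ← hn] at this
  -- Transversal: the least elements of noncentral classes in [0, n), with one central element added
  -- if there is any.
  set T : Finset (Fin n) := {i | IsClassMin R r ((i : ℕ) : ℤ)} with hT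
  have hTcard : T.card = m * ({z : ZMod r | periodSizes R z ≠ 0} : Finset (ZMod r)).card := by
    rw [← hR.card_isClassMin_range m]
    refine Finset.card_bij (fun i _ => ((i : ℕ) : ℤ)) ?_ ?_ ?_
    · intro i hi
      simp only [hT, Finset.mem_filter, Finset.mem_univ, true_and, Finset.mem_Ico] at hi ⊢
      have : ((n : ℕ) : ℤ) = r * m := by rw [hn]; push_cast; rfl
      exact ⟨by omega, hi⟩
    · intro i _ j _ hij
      exact Fin.ext (by exact_mod_cast hij)
    · intro u hu
      have hnr : ((n : ℕ) : ℤ) = r * m := by rw [hn]; push_cast; rfl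
      simp only [Finset.mem_filter, Finset.mem_Ico, ← hnr] at hu
      have hval : ((intToFin n u : ℕ) : ℤ) = u := by
        rw [intToFin_val, Int.emod_eq_of_lt hu.1.1 hu.1.2]
      refine ⟨intToFin n u, ?_, hval⟩
      simp only [hT, Finset.mem_filter, Finset.mem_univ, true_and]
      rw [hval]
      exact hu.2
  have hTex : ∀ i : Fin n, ¬ R ((i : ℕ) : ℤ) (((i : ℕ) : ℤ) + r) →
      ∃ t ∈ T, blockSetoid π i t := by
    intro i hi
    obtain ⟨p, -, hp, hpm⟩ := hR.exists_isClassMin hi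
    refine ⟨intToFin n p, ?_, (hS _ _).2 ⟨p / n, ?_⟩⟩
    · simp only [hT, Finset.mem_filter, Finset.mem_univ, true_and]
      rw [← hmin _ (p / n), ← eq_intToFin_add]
      exact hpm
    · rw [← eq_intToFin_add]
      exact R.symm hp
  have hTuniq : ∀ t ∈ T, ∀ t' ∈ T, blockSetoid π t t' → t = t' := by
    intro t ht t' ht' h
    simp only [hT, Finset.mem_filter, Finset.mem_univ, true_and] at ht ht'
    obtain ⟨a, ha⟩ := (hS _ _).1 h
    have := IsPeriodicNoncrossing.isClassMin_unique ht ((hmin _ a).2 ht') ha (R.refl _)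
    rw [← intToFin_natCast t, this, intToFin_add_mul, intToFin_natCast]
  rw [← hTcard]
  split_ifs with hc
  · obtain ⟨x, hx⟩ := hc
    have hx' : R ((intToFin n x : ℕ) : ℤ) (((intToFin n x : ℕ) : ℤ) + r) := by
      rw [← hcen _ (x / n), ← eq_intToFin_add]
      exact hx
    have hnotin : intToFin n x ∉ T := by
      simp only [hT, Finset.mem_filter, Finset.mem_univ, true_and]
      exact fun h => h.1 hx'
    have hne : ∀ t ∈ T, ¬ blockSetoid π t (intToFin n x) := by
      intro t ht h
      simp only [hT, Finset.mem_filter, Finset.mem_univ, true_and] at ht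
      obtain ⟨a, ha⟩ := (hS _ _).1 h
      exact ht.1 (hR.central_of_rel (R.symm ha) ((hcen _ a).2 hx'))
    rw [← Finset.card_insert_of_notMem hnotin]
    refine card_parts_eq_of_transversal _ (fun i => ?_) fun t ht t' ht' h => ?_
    · by_cases hi : R ((i : ℕ) : ℤ) (((i : ℕ) : ℤ) + r)
      · refine ⟨_, Finset.mem_insert_self _ _, (hS _ _).2 ⟨0, ?_⟩⟩
        rw [mul_zero, add_zero]
        exact hR.rel_of_central hr hi hx'
      · obtain ⟨t, ht, hit⟩ := hTex i hi
        exact ⟨t, Finset.mem_insert_of_mem ht, hit⟩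
    · rcases Finset.mem_insert.1 ht with rfl | ht <;> rcases Finset.mem_insert.1 ht' with rfl | ht'
      · rfl
      · exact absurd ((blockSetoid π).symm h) (hne t' ht')
      · exact absurd h (hne t ht)
      · exact hTuniq t ht t' ht' h
  · push Not at hc
    exact card_parts_eq_of_transversal _ (fun i => hTex i (hc _)) hTuniq

/-- Invariant noncrossing partitions correspond to functions on `ℤ/rℤ` with sum at most `r`. -/
theorem card_isShiftInvariant (hn : n = r * m) (hm : 2 ≤ m) (k : ℕ) :
    Nat.card {π : NoncrossingPartition n k //
      IsShiftInvariant r ((blockSetoid π.1).comap (intToFin n))} =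
    Nat.card {s : ZMod r → ℕ // ∑ z, s z ≤ r ∧
      m * ({z | s z ≠ 0} : Finset (ZMod r)).card + (if ∑ z, s z < r then 1 else 0) = k} := by
  classical
  have hr : 0 < r := NeZero.pos r
  have hrn : 2 * r ≤ n := by rw [hn, mul_comm]; exact Nat.mul_le_mul_left r hm
  have hQ : ∀ π : {π : NoncrossingPartition n k //
      IsShiftInvariant r ((blockSetoid π.1).comap (intToFin n))},
      IsCyclicNoncrossing n r ((blockSetoid π.1.1).comap (intToFin n)) := fun π =>
    isCyclicNoncrossing_comap (isNoncrossing_iff.1 π.1.2.1) π.2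
  have hcen : ∀ {R : Setoid ℤ}, IsPeriodicNoncrossing r R →
      ((∃ x, R x (x + r)) ↔ ∑ z : ZMod r, periodSizes R z < r) := by
    intro R hR
    simp only [hR.central_iff]
    exact ⟨fun ⟨x, hx⟩ => hx.sum_lt, exists_isRecordLow⟩
  refine Nat.card_congr (Equiv.ofBijective
    (fun π => ⟨periodSizes ((hQ π).unroll hrn hr), ?_, ?_⟩) ⟨?_, ?_⟩)
  · exact ((hQ π).isPeriodicNoncrossing_unroll hrn hr).sum_periodSizes_le
  · refine Eq.trans ?_ π.1.2.2
    rw [card_parts_of_isCyclicNoncrossing (hQ π) hn hr hrn,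
      if_congr (hcen ((hQ π).isPeriodicNoncrossing_unroll hrn hr)) rfl rfl]
  · intro π π' h
    have h1 : periodSizes (r := r) ((hQ π).unroll hrn hr) =
        periodSizes ((hQ π').unroll hrn hr) := congrArg Subtype.val h
    have h2 := congrArg Subtype.val ((periodicNoncrossingEquiv r).injective
      (a₁ := ⟨_, (hQ π).isPeriodicNoncrossing_unroll hrn hr⟩)
      (a₂ := ⟨_, (hQ π').isPeriodicNoncrossing_unroll hrn hr⟩) (Subtype.ext h1))
    have h3 : (hQ π).unroll hrn hr = (hQ π').unroll hrn hr := h2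
    have h4 : ∀ {R R' : Setoid ℤ} (hR : IsPeriodicNoncrossing r R)
        (hR' : IsPeriodicNoncrossing r R'), R = R' → hR.roll hn = hR'.roll hn := by
      rintro R _ hR hR' rfl
      rfl
    have h5 := h4 ((hQ π).isPeriodicNoncrossing_unroll hrn hr)
      ((hQ π').isPeriodicNoncrossing_unroll hrn hr) h3
    rw [(hQ π).roll_unroll hn hr hrn, (hQ π').roll_unroll hn hr hrn] at h5
    exact Subtype.ext (Subtype.ext (blockSetoid_injective (comap_intToFin_injective h5)))
  · rintro ⟨s, hs, hk⟩
    obtain ⟨⟨R, hR⟩, hRs⟩ := (periodicNoncrossingEquiv r).surjective ⟨s, hs⟩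
    obtain rfl : periodSizes R = s := congrArg Subtype.val hRs
    have hroll := hR.isCyclicNoncrossing_roll hn (by omega)
    obtain ⟨π, hπ⟩ := (blockSetoidEquiv n).surjective
      ((hR.roll hn).comap fun i : Fin n => ((i : ℕ) : ℤ))
    replace hπ : blockSetoid π = _ := hπ
    have hcomap : (blockSetoid π).comap (intToFin n) = hR.roll hn := by
      rw [hπ, comap_comap_intToFin hroll]
    have hnc : IsNoncrossing π := isNoncrossing_iff.2 fun a b c d hab hbc hcd => by
      rw [hπ]
      simp only [Setoid.comap_rel, Fin.lt_def] at *
      exact hroll.noncrossing _ _ _ _ (by omega) (by omega) (by omega) (by omega)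
    have hcyc : IsCyclicNoncrossing n r ((blockSetoid π).comap (intToFin n)) := hcomap ▸ hroll
    have hunroll : hcyc.unroll hrn hr = R := by
      have h4 : ∀ {Q Q' : Setoid ℤ} (hQ : IsCyclicNoncrossing n r Q)
          (hQ' : IsCyclicNoncrossing n r Q'), Q = Q' → hQ.unroll hrn hr = hQ'.unroll hrn hr := by
        rintro Q _ hQ hQ' rfl
        rfl
      rw [h4 hcyc hroll hcomap]
      exact hR.unroll_roll hn hm hr hrn
    have hcard : π.parts.card = k := by
      rw [card_parts_of_isCyclicNoncrossing hcyc hn hr hrn,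
        if_congr (hcen (hcyc.isPeriodicNoncrossing_unroll hrn hr)) rfl rfl]
      simp only [hunroll]
      exact hk
    exact ⟨⟨⟨π, hnc, hcard⟩, hcyc.toIsShiftInvariant⟩, Subtype.ext (by simp only [hunroll])⟩

/-- As m ≥ 2 divides the number of blocks, there is no central block: the sum is exactly r. -/
theorem card_isShiftInvariant_of_dvd (hn : n = r * m) (hm : 2 ≤ m) (j : ℕ) :
    Nat.card {π : NoncrossingPartition n (m * (j + 1)) //
      IsShiftInvariant r ((blockSetoid π.1).comap (intToFin n))} =
    r.choose (j + 1) * (r - 1).choose j := by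
  classical
  obtain ⟨R, rfl⟩ : ∃ R, r = R + 1 := ⟨r - 1, by have := NeZero.pos r; omega⟩
  rw [card_isShiftInvariant hn hm]
  have h := card_sumSupport (ι := ZMod (R + 1)) R j
  rw [ZMod.card] at h
  rw [Nat.add_sub_cancel, ← h]
  refine Nat.subtype_card _ fun s => ?_
  rw [mem_sumSupport]
  constructor
  · rintro ⟨h1, h2⟩
    exact ⟨h1.le, by rw [h2, h1, if_neg (lt_irrefl _), add_zero]⟩
  · rintro ⟨h1, h2⟩
    split_ifs at h2 with h3
    · exfalso
      have : m ∣ 1 := (Nat.dvd_add_right (dvd_mul_right m _)).1 (h2 ▸ dvd_mul_right m (j + 1))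
      have := Nat.le_of_dvd one_pos this
      omega
    · exact ⟨by omega, Nat.eq_of_mul_eq_mul_left (by omega) h2⟩

/-- Here the central block must be present, so the sum ranges over all values below r. -/
theorem card_isShiftInvariant_of_dvd_pred (hn : n = r * m) (hm : 2 ≤ m) (j : ℕ) :
    Nat.card {π : NoncrossingPartition n (m * j + 1) //
      IsShiftInvariant r ((blockSetoid π.1).comap (intToFin n))} =
    r.choose j * (r - 1).choose j := by
  classical
  obtain ⟨R, rfl⟩ : ∃ R, r = R + 1 := ⟨r - 1, by have := NeZero.pos r; omega⟩
  rw [card_isShiftInvariant hn hm]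
  have h := sum_card_sumSupport (ι := ZMod (R + 1)) R j
  rw [ZMod.card] at h
  rw [Nat.add_sub_cancel, ← h, ← Finset.card_biUnion]
  · refine Nat.subtype_card _ fun s => ?_
    simp only [Finset.mem_biUnion, Finset.mem_range, mem_sumSupport]
    constructor
    · rintro ⟨N, hN, rfl, h2⟩
      exact ⟨hN.le, by rw [h2, if_pos hN]⟩
    · rintro ⟨h1, h2⟩
      split_ifs at h2 with h3
      · exact ⟨_, h3, rfl, Nat.eq_of_mul_eq_mul_left (by omega) (Nat.add_right_cancel h2)⟩
      · exfalso
        have : m ∣ 1 := (Nat.dvd_add_right (dvd_mul_right m j)).1 (h2 ▸ dvd_mul_right m _)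
        have := Nat.le_of_dvd one_pos this
        omega
  · intro N _ N' _ hne
    rw [Function.onFun, Finset.disjoint_left]
    intro s hs hs'
    rw [mem_sumSupport] at hs hs'
    exact hne (hs.1.symm.trans hs'.1)

theorem card_isShiftInvariant_eq_zero (hn : n = r * m) (hm : 2 ≤ m) {k : ℕ} (h0 : ¬ m ∣ k)
    (h1 : ¬ m ∣ k + 1) : Nat.card {π : NoncrossingPartition n (k + 1) //
      IsShiftInvariant r ((blockSetoid π.1).comap (intToFin n))} = 0 := by
  rw [card_isShiftInvariant hn hm]
  refine @Nat.card_of_isEmpty _ ⟨?_⟩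
  rintro ⟨s, -, hs⟩
  split_ifs at hs
  · exact h0 ⟨_, (Nat.add_right_cancel hs).symm⟩
  · exact h1 ⟨_, hs.symm⟩

end Fixed

/-! ### Cyclic sieving -/

theorem card_noncrossingPartition_eq_eval {a b : ℕ} {P : ℕ[X]}
    (hP : toRatFunc P = qNarayana (a + 1 + b) (a + 1)) :
    Nat.card (NoncrossingPartition (a + 1 + b) (a + 1)) = P.eval 1 := by
  classical
  have h1 := mul_card_isRecordLow_zero (a + 1 + b) (a + 1)
  rw [← card_noncrossingPartition, show a + 1 + b = a + b + 1 by omega, card_sumSupport,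
    ZMod.card] at h1
  have h2 := mul_eval_one_of_eq_qNarayana hP
  -- With n = a + b + 1, this converts C(n+1, k) C(n-1, k-1) / (n+1) from the cycle lemma into C(n,
  -- k-1) C(n-1, k-1) / k.
  have h3 := Nat.add_one_mul_choose_eq (a + b + 1) a
  rw [show a + 1 + b = a + b + 1 by omega] at h2 ⊢
  apply Nat.eq_of_mul_eq_mul_left (show 0 < (a + b + 1 + 1) * (a + 1) by positivity)
  calc (a + b + 1 + 1) * (a + 1) * Nat.card (NoncrossingPartition (a + b + 1) (a + 1))
      = (a + 1) * ((a + b + 1 + 1) * Nat.card (NoncrossingPartition (a + b + 1) (a + 1))) := by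
        ring
    _ = (a + b + 1 + 1) * (a + 1) * P.eval 1 := by
        rw [h1, mul_assoc (a + b + 1 + 1), h2, ← mul_assoc, ← mul_assoc, h3]
        ring

section Action

variable {n : ℕ}

theorem ofAdd_one_pow (t : ℕ) :
    Multiplicative.ofAdd (1 : ZMod n) ^ t = Multiplicative.ofAdd (t : ZMod n) := by
  rw [← ofAdd_nsmul, nsmul_one]

theorem zpowers_ofAdd_one [NeZero n] : Subgroup.zpowers (Multiplicative.ofAdd (1 : ZMod n)) = ⊤ := by
  rw [eq_top_iff]
  intro x _
  refine Subgroup.mem_zpowers_iff.2 ⟨(x.toAdd.val : ℕ), ?_⟩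
  rw [zpow_natCast, ofAdd_one_pow, ZMod.natCast_zmod_val, ofAdd_toAdd]

/-- By Bézout, c^d and c^gcd(n,d) are powers of each other. -/
theorem ofAdd_one_pow_smul_eq_iff {X : Type*} [MulAction (Multiplicative (ZMod n)) X] (d : ℕ)
    (x : X) : Multiplicative.ofAdd (1 : ZMod n) ^ d • x = x ↔
      Multiplicative.ofAdd (1 : ZMod n) ^ (n.gcd d) • x = x := by
  set c := Multiplicative.ofAdd (1 : ZMod n)
  have hcn : c ^ n = 1 := by rw [ofAdd_one_pow, ZMod.natCast_self, ofAdd_zero]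
  rw [← MulAction.mem_stabilizer_iff, ← MulAction.mem_stabilizer_iff]
  constructor
  · intro h
    have h1 : c ^ n.gcd d = (c ^ d) ^ n.gcdB d := by
      rw [← zpow_natCast c (n.gcd d), Nat.gcd_eq_gcd_ab, zpow_add, zpow_mul, zpow_mul,
        zpow_natCast, zpow_natCast, hcn, one_zpow, one_mul]
    rw [h1]
    exact Subgroup.zpow_mem _ h _
  · intro h
    obtain ⟨e, he⟩ := Nat.gcd_dvd_right n d
    rw [he, pow_mul]
    exact Subgroup.pow_mem _ h e

theorem card_fixedBy [NeZero n] (k d : ℕ) :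
    Nat.card (MulAction.fixedBy (NoncrossingPartition n k)
      (Multiplicative.ofAdd (1 : ZMod n) ^ d)) =
    Nat.card {π : NoncrossingPartition n k //
      IsShiftInvariant (n.gcd d) ((blockSetoid π.1).comap (intToFin n))} := by
  refine Nat.card_congr (Equiv.subtypeEquivRight fun π => ?_)
  rw [MulAction.mem_fixedBy, ofAdd_one_pow_smul_eq_iff, ofAdd_one_pow,
    ← permutePartition_cyclicRotation_eq_self_iff]
  exact Subtype.ext_iff

end Action

theorem theorem1p2 (n k : ℕ) [NeZero n] (hk : 1 ≤ k) (hkn : k ≤ n) :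
    ∃ P : ℕ[X],
      algebraMap ℚ[X] (RatFunc ℚ) (P.map (Nat.castRingHom ℚ)) = qNarayana n k ∧
      ExhibitsCSP (NoncrossingPartition n k) (Multiplicative.ofAdd (1 : ZMod n)) P := by
  obtain ⟨a, rfl⟩ : ∃ a, k = a + 1 := ⟨k - 1, by omega⟩
  obtain ⟨b, hb⟩ : ∃ b, n = a + 1 + b := ⟨n - (a + 1), by omega⟩
  obtain ⟨P, hP⟩ : ∃ P : ℕ[X], toRatFunc P = qNarayana n (a + 1) :=
    hb ▸ exists_toRatFunc_eq_qNarayana a b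
  refine ⟨P, hP, zpowers_ofAdd_one, fun ζ hζ d => ?_⟩
  rw [Nat.card_congr Multiplicative.toAdd, Nat.card_zmod] at hζ
  have hn0 : 0 < n := NeZero.pos n
  have hω := IsPrimitiveRoot.orderOf (ζ ^ d)
  rw [IsOfFinOrder.orderOf_pow ζ d (orderOf_pos_iff.1 (hζ ▸ hn0)), hζ] at hω
  have hr : 0 < n.gcd d := Nat.gcd_pos_of_pos_left d hn0
  have hn : n = n.gcd d * (n / n.gcd d) := (Nat.mul_div_cancel' (Nat.gcd_dvd_left n d)).symm
  have hm0 : 0 < n / n.gcd d := Nat.pos_of_ne_zero fun h => by rw [h, mul_zero] at hn; omega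
  set m := n / n.gcd d with hm
  -- m is the order of ζ^d. For m = 1 every partition is fixed and P is evaluated at 1; unrolling
  -- needs m ≥ 2.
  rcases (show m = 1 ∨ 2 ≤ m by omega) with h1 | h2
  · have hnd : n ∣ d := by
      rw [h1, mul_one] at hn
      exact Nat.gcd_eq_left_iff_dvd.1 hn.symm
    have hone : Multiplicative.ofAdd (1 : ZMod n) ^ d = 1 := by
      rw [ofAdd_one_pow, (ZMod.natCast_eq_zero_iff d n).2 hnd, ofAdd_zero]
    rw [h1, IsPrimitiveRoot.one_right_iff] at hω
    subst hb
    have hall : MulAction.fixedBy (NoncrossingPartition (a + 1 + b) (a + 1))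
        (1 : Multiplicative (ZMod (a + 1 + b))) = Set.univ := MulAction.fixedBy_one_eq_univ _ _
    rw [hone, hall, Nat.card_congr (Equiv.Set.univ _), card_noncrossingPartition_eq_eval hP, hω]
    rw [← map_one (algebraMap ℕ ℂ), aeval_algebraMap_apply]
    simp
  · rw [card_fixedBy]
    have : NeZero (n.gcd d) := ⟨hr.ne'⟩
    have hn' : n = m * n.gcd d := by rw [mul_comm]; exact hn
    by_cases hdvd : m ∣ a + 1
    · obtain ⟨j, hj⟩ := hdvd
      obtain ⟨j, rfl⟩ : ∃ i, j = i + 1 := by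
        refine ⟨j - 1, ?_⟩
        have : j ≠ 0 := by rintro rfl; omega
        omega
      have hjr : j + 1 ≤ n.gcd d := by
        rw [hj] at hkn
        exact Nat.le_of_mul_le_mul_left (hn' ▸ hkn) hm0
      rw [hj] at hP ⊢
      rw [card_isShiftInvariant_of_dvd hn h2 j]
      refine (hω.aeval_qNarayana_of_dvd h2 hjr ?_).symm
      rw [← hn', hP]
    by_cases hdvd' : m ∣ a
    · obtain ⟨j, rfl⟩ := hdvd'
      have hjr : j < n.gcd d := by
        by_contra hle
        have := Nat.mul_le_mul_left m (not_lt.1 hle)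
        omega
      rw [card_isShiftInvariant_of_dvd_pred hn h2 j]
      refine (hω.aeval_qNarayana_of_dvd_pred h2 hjr ?_).symm
      rw [← hn', hP]
    · rw [card_isShiftInvariant_eq_zero hn h2 hdvd' hdvd, Nat.cast_zero]
      refine (hω.aeval_qNarayana_eq_zero h2 (r := n.gcd d) (k := a) (by omega) hdvd' hdvd ?_).symm
      rw [← hn', hP]
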